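/- Let $\mathbf X, \mathbf X_1, \dots, \mathbf X_n$ be i.i.d. centered random vectors in $\mathbb R^d$, $d \ge 1$, with finite second moments and invertible covariance matrix $\Sigma = \mathbb E\, \mathbf X \mathbf X^\top$. Put $\widehat\Sigma = \frac1n \sum_{i=1}^n \mathbf X_i \mathbf X_i^\top$ and $\boldsymbol\xi = \Sigma^{-1/2} \mathbf X$. Let $\|A\|$ and $\|A\|_{\rm F}$ denote the operator norm and the Frobenius norm of a matrix $A$, let $\mathtt r(A) = {\rm Tr}(A) / \|A\|$ be the effective rank of a symmetric positive semidefinite matrix $A \neq O$, and let $a \vee b = \max\{a, b\}$. Assume that, for some $\alpha > 0$, \[ \mathbb E \left( \boldsymbol \xi^\top V \boldsymbol \xi - \mathbb E \, \boldsymbol \xi^\top V \boldsymbol \xi \right)^4 \leq \alpha^2 \, \|V\|_{\rm F}^4 \quad \text{for all } V \in \mathbb R^{d \times d}, \] and that the sample size $n$ satisfies \[ 7 \alpha^2 \mathtt r(\Sigma^2)^2 \left( \mathtt r(\Sigma)^2 + \alpha \mathtt r(\Sigma^2) \right) \leq n \quad \text{and} \quad 96 \left(1 + \sqrt{\alpha}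 \right)^2 \mathtt r(\Sigma^2) \left( \mathtt r(\Sigma)^2 + \alpha \mathtt r(\Sigma^2) \right) \leq n. \] Then $\mathbb E \|\widehat \Sigma - \Sigma\|_{\rm F}^2 < \infty$ and, for any $\delta \in (0, 1)$, with probability at least $1 - \delta$, \[ \left\|\widehat \Sigma - \Sigma \right\|_{\rm F}^2 - \mathbb E \left\|\widehat \Sigma - \Sigma \right\|_{\rm F}^2 > -\frac{4 \|\Sigma\|^2}n \left( 2 \log(5/\delta) \vee \sqrt{2 \mathfrak R(\Sigma) \log(5/\delta)} \right), \] where \[ \mathfrak R(\Sigma) = \alpha \mathtt r(\Sigma^2)^2 + \alpha^2 \mathtt r(\Sigma^4) + \frac{15 \alpha^2 \mathtt r(\Sigma)^2 \mathtt r(\Sigma^2) \left( \mathtt r(\Sigma)^2 + \alpha \mathtt r(\Sigma^2) \right)}{4n}. \] -/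

import Mathlib

open MeasureTheory ProbabilityTheory

namespace CovEst

noncomputable section

section Frobenius
open scoped Matrix.Norms.Frobenius

/-- The Frobenius norm of a square real matrix (Mathlib's Frobenius norm). -/
def frobNorm {d : ℕ} (A : Matrix (Fin d) (Fin d) ℝ) : ℝ := ‖A‖

end Frobenius

section Operator
open scoped Matrix.Norms.L2Operator

/-- The operator norm of a square real matrix acting on Euclidean space. -/
def opNorm {d : ℕ} (A : Matrix (Fin d) (Fin d) ℝ) : ℝ := ‖A‖

end Operator

/-- The effective rank `Tr(A) / ‖A‖` (used for positive semidefinite `A ≠ 0`). -/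
def effRank {d : ℕ} (A : Matrix (Fin d) (Fin d) ℝ) : ℝ := A.trace / opNorm A

/-- The matrix `E[X Xᵀ]` of second moments of a random vector `X`. -/
def secondMoment {Ω : Type*} [MeasurableSpace Ω] {d : ℕ} (P : Measure Ω)
    (X : Ω → Fin d → ℝ) : Matrix (Fin d) (Fin d) ℝ :=
  Matrix.of fun i j => ∫ ω, X ω i * X ω j ∂P

/-- The sample covariance `(1/n) ∑ᵢ xᵢ xᵢᵀ` of the observations `x₁, …, xₙ`. -/
def sampleCov {d n : ℕ} (x : Fin n → Fin d → ℝ) : Matrix (Fin d) (Fin d) ℝ :=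
  (n : ℝ)⁻¹ • ∑ i, Matrix.vecMulVec (x i) (x i)

section Whitening
open scoped MatrixOrder

/-- The whitened vector `S^{-1/2} x`. -/
def whiten {d : ℕ} (S : Matrix (Fin d) (Fin d) ℝ) (x : Fin d → ℝ) : Fin d → ℝ :=
  Matrix.mulVec (CFC.sqrt S)⁻¹ x

end Whitening

/-- The quadratic form `xᵀ V x`. -/
def quadForm {d : ℕ} (V : Matrix (Fin d) (Fin d) ℝ) (x : Fin d → ℝ) : ℝ :=
  x ⬝ᵥ Matrix.mulVec V x

/-- The fourth-moment condition with parameter `α > 0` on the quadratic forms of a random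
vector `ξ`: for every matrix `V`, the centred form `ξᵀ V ξ - E ξᵀ V ξ` has a finite fourth moment,
which is at most `α² ‖V‖_F⁴`. -/
def FourthMomentCondition {Ω : Type*} [MeasurableSpace Ω] {d : ℕ} (P : Measure Ω)
    (ξ : Ω → Fin d → ℝ) (α : ℝ) : Prop :=
  0 < α ∧ ∀ V : Matrix (Fin d) (Fin d) ℝ,
    Integrable (fun ω => (quadForm V (ξ ω) - ∫ ω', quadForm V (ξ ω') ∂P) ^ 4) P ∧
    ∫ ω, (quadForm V (ξ ω) - ∫ ω', quadForm V (ξ ω') ∂P) ^ 4 ∂P ≤ α ^ 2 * frobNorm V ^ 4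

/-- The variance factor
`α r(S²)² + α² r(S⁴) + 15 α² r(S)² r(S²) (r(S)² + α r(S²)) / (4n)`. -/
def varFactor {d : ℕ} (S : Matrix (Fin d) (Fin d) ℝ) (α : ℝ) (n : ℕ) : ℝ :=
  α * effRank (S ^ 2) ^ 2 + α ^ 2 * effRank (S ^ 4)
    + 15 * α ^ 2 * effRank S ^ 2 * effRank (S ^ 2) * (effRank S ^ 2 + α * effRank (S ^ 2))
      / (4 * (n : ℝ))

end

end CovEst

namespace CovEst

open scoped Kronecker

/-! Let `A i` be the vectorised matrix (Xᵢ Xᵢᵀ - Σ) / ‖Σ‖ and W = |∑ A i|² / n. Then ‖Σ̂ - Σ‖_F² =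
‖Σ‖² W / n and E W = Tr Q, with Q the second-moment matrix of one summand. A lower tail only needs E
exp(-l W) for l ≥ 0, which is finite without exponential moments.

Since exp(-l W) is a Gaussian characteristic function at ∑ A i, Fubini and independence turn its
mean into a Gaussian average over g of φ(g)ⁿ, with φ the characteristic function of one summand
(`integral_exp_neg_sq_norm_sum_le`). Four moments of g·A give |φ(g)|ⁿ ≤ exp(-l gᵀQg + c (gᵀBg)²),
where B = Σ ⊗ Σ / ‖Σ‖² (`norm_pow_integral_cexp_le`). The quartic term is not Gaussian-integrable,
so g is split at gᵀBg = 4τ, τ = r(Σ)² + α r(Σ²): below, the quartic is dominated by a small multiple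
of gᵀBg; above, |φ| ≤ 1 and the region is exponentially rare. Both parts become Gaussian integrals
of exponentials of quadratic forms (`integral_exp_neg_le_two_mul_exp`).

Chernoff's bound (`measureReal_le_two_mul_exp_neg`) finishes, once Tr Q and Tr Q² are bounded by
effective ranks through the fourth-moment condition (`integral_centredVec_kronecker_le`). -/

/-! ### Scalar inequalities and the one-dimensional Gaussian integral -/

lemma one_le_one_sub_mul_exp {x : ℝ} (hx : x ≤ 1 / 2) :
    1 ≤ (1 - x) * Real.exp (x + x ^ 2) := by
  rcases le_total 0 x with h0 | h0
  · have h := Real.quadratic_le_exp_of_nonneg (x := x + x ^ 2) (by positivity)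
    have h1 : (1 - x) * (1 + (x + x ^ 2) + (x + x ^ 2) ^ 2 / 2)
        ≤ (1 - x) * Real.exp (x + x ^ 2) := by
      apply mul_le_mul_of_nonneg_left h; linarith
    refine le_trans ?_ h1
    -- The left factor times the quadratic Taylor bound equals 1 + (x²/2)(1 - x - x² - x³).
    have h2 : 0 ≤ 1 - x - x ^ 2 - x ^ 3 := by nlinarith [mul_nonneg h0 h0]
    nlinarith [mul_nonneg (mul_nonneg h0 h0) h2]
  · have h := Real.add_one_le_exp (x + x ^ 2)
    have h1 : (1 - x) * (1 + x + x ^ 2) ≤ (1 - x) * Real.exp (x + x ^ 2) := by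
      apply mul_le_mul_of_nonneg_left _ (by linarith)
      linarith
    refine le_trans ?_ h1
    nlinarith [mul_nonneg (sq_nonneg x) (neg_nonneg.2 h0)]

lemma sub_cube_div_six_le_sin {y : ℝ} (hy : 0 ≤ y) : y - y ^ 3 / 6 ≤ Real.sin y := by
  have hmono : Monotone (fun z : ℝ => Real.sin z - z + z ^ 3 / 6) := by
    have hd : ∀ z : ℝ, HasDerivAt (fun z : ℝ => Real.sin z - z + z ^ 3 / 6)
        (Real.cos z - 1 + (3 * z ^ 2) / 6) z := fun z => by
      have h := ((Real.hasDerivAt_sin z).sub (hasDerivAt_id z)).add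
        ((hasDerivAt_pow 3 z).div_const 6)
      norm_num at h
      exact h
    refine monotone_of_deriv_nonneg (fun z => (hd z).differentiableAt) fun z => ?_
    rw [(hd z).deriv]
    linarith [Real.one_sub_sq_div_two_le_cos (x := z)]
  have := hmono hy
  simp only [Real.sin_zero] at this
  linarith

/-- With x = 2y, cos x = 1 - 2 sin² y, so the cubic lower bound for sin can be squared while it is
nonnegative. For y² ≥ 3 the right side is already at least 1. -/
lemma cos_le_quartic (x : ℝ) : Real.cos x ≤ 1 - x ^ 2 / 2 + x ^ 4 / 24 := by
  wlog hx : 0 ≤ x generalizing x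
  · have := this (-x) (by linarith)
    rw [Real.cos_neg] at this
    nlinarith [this]
  obtain ⟨y, rfl⟩ : ∃ y, x = 2 * y := ⟨x / 2, by ring⟩
  have hy : 0 ≤ y := by linarith
  rw [Real.cos_two_mul, Real.cos_sq']
  have hs := sub_cube_div_six_le_sin hy
  rcases le_total (y ^ 2) 3 with h | h
  · have h0 : 0 ≤ y - y ^ 3 / 6 := by nlinarith [mul_nonneg hy (sub_nonneg.2 h)]
    have := pow_le_pow_left₀ h0 hs 2
    nlinarith [sq_nonneg (y ^ 3)]
  · nlinarith [sq_nonneg (Real.sin y), mul_nonneg (sq_nonneg y) (sub_nonneg.2 h)]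

lemma integrable_exp_mul_sq_gaussianReal {m : ℝ} (hm : m ≤ 1 / 4) :
    Integrable (fun x : ℝ => Real.exp (m * x ^ 2)) (gaussianReal 0 1) ∧
      ∫ x, Real.exp (m * x ^ 2) ∂(gaussianReal 0 1) ≤ Real.exp (m + 2 * m ^ 2) := by
  have hpdf : ∀ x : ℝ, gaussianPDFReal 0 1 x • Real.exp (m * x ^ 2)
      = (√(2 * Real.pi))⁻¹ * Real.exp (-(1 / 2 - m) * x ^ 2) := fun x => by
    simp only [gaussianPDFReal_def, smul_eq_mul, NNReal.coe_one, mul_one, sub_zero]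
    rw [mul_assoc, ← Real.exp_add]
    congr 2
    ring
  have hb : 0 < 1 / 2 - m := by linarith
  constructor
  · rw [gaussianReal_of_var_ne_zero _ one_ne_zero, gaussianPDF_def,
      integrable_withDensity_iff_integrable_smul₀' (by fun_prop) (by simp)]
    refine ((integrable_exp_neg_mul_sq hb).const_mul (√(2 * Real.pi))⁻¹).congr
      (Filter.Eventually.of_forall fun x => ?_)
    simp only
    rw [ENNReal.toReal_ofReal (gaussianPDFReal_nonneg _ _ _), hpdf]
  · rw [integral_gaussianReal_eq_integral_smul one_ne_zero]
    simp_rw [hpdf]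
    rw [integral_const_mul, integral_gaussian, ← Real.sqrt_inv, ← Real.sqrt_mul (by positivity)]
    -- The integral is (1 - 2m)^(-1/2), so half of the exponent 2m + (2m)² remains.
    have h := one_le_one_sub_mul_exp (x := 2 * m) (by linarith)
    have e : (2 * Real.pi)⁻¹ * (Real.pi / (1 / 2 - m)) = (1 - 2 * m)⁻¹ := by
      have := Real.pi_pos.ne'
      have h2 : 1 / 2 - m ≠ 0 := hb.ne'
      have h3 : 1 - 2 * m ≠ 0 := by linarith
      field_simp
    rw [e]
    apply Real.sqrt_le_iff.2 ⟨by positivity, ?_⟩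
    rw [← Real.exp_nat_mul]
    rw [inv_le_iff_one_le_mul₀' (by linarith)]
    refine h.trans_eq ?_
    congr 2
    push_cast
    ring

/-! ### Gaussian integrals of exponentials of quadratic forms -/

section Gaussian

variable {ι : Type*} [Fintype ι] [DecidableEq ι]

lemma eigenvectorBasis_repr_quadratic {M : Matrix ι ι ℝ} (hM : M.IsHermitian) (x : ι → ℝ) :
    (∑ i, x i • hM.eigenvectorBasis i).ofLp ⬝ᵥ
      M.mulVec (∑ i, x i • hM.eigenvectorBasis i).ofLp = ∑ i, hM.eigenvalues i * x i ^ 2 := by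
  have h1 : M.mulVec (∑ i, x i • hM.eigenvectorBasis i).ofLp
      = (∑ i, (hM.eigenvalues i * x i) • hM.eigenvectorBasis i).ofLp := by
    simp only [WithLp.ofLp_sum, WithLp.ofLp_smul, Matrix.mulVec_sum, Matrix.mulVec_smul,
      hM.mulVec_eigenvectorBasis, smul_smul, mul_comm]
  rw [h1]
  have h2 := hM.eigenvectorBasis.sum_inner_mul_inner
    (∑ i, x i • hM.eigenvectorBasis i) (∑ i, (hM.eigenvalues i * x i) • hM.eigenvectorBasis i)
  rw [dotProduct_comm]
  have h3 : (∑ i, (hM.eigenvalues i * x i) • hM.eigenvectorBasis i).ofLp ⬝ᵥ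
      (∑ i, x i • hM.eigenvectorBasis i).ofLp = inner ℝ (∑ i, x i • hM.eigenvectorBasis i)
        (∑ i, (hM.eigenvalues i * x i) • hM.eigenvectorBasis i) := by
    rw [EuclideanSpace.inner_eq_star_dotProduct]; simp
  rw [h3, hM.eigenvectorBasis.orthonormal.inner_sum]
  simp
  exact Finset.sum_congr rfl fun i _ => by ring

lemma trace_sq_eq_sum_eigenvalues {M : Matrix ι ι ℝ} (hM : M.IsHermitian) :
    (M * M).trace = ∑ i, hM.eigenvalues i ^ 2 := by
  conv_lhs => rw [hM.spectral_theorem, ← map_mul, Unitary.conjStarAlgAut_apply,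
    Matrix.trace_mul_cycle, Unitary.coe_star_mul_self, one_mul, Matrix.diagonal_mul_diagonal,
    Matrix.trace_diagonal]
  exact Finset.sum_congr rfl fun i _ => by simp [sq]

/-- By rotation invariance the coordinates in an eigenbasis of M are independent standard Gaussians,
so the integral factors over the eigenvalues. -/
lemma integral_exp_quadratic_stdGaussian {M : Matrix ι ι ℝ} (hM : M.IsHermitian)
    (hle : ∀ v : ι → ℝ, v ⬝ᵥ M.mulVec v ≤ 1 / 4 * (v ⬝ᵥ v)) :
    Integrable (fun g : EuclideanSpace ℝ ι => Real.exp (g.ofLp ⬝ᵥ M.mulVec g.ofLp))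
        (stdGaussian (EuclideanSpace ℝ ι)) ∧
      ∫ g : EuclideanSpace ℝ ι, Real.exp (g.ofLp ⬝ᵥ M.mulVec g.ofLp)
        ∂(stdGaussian (EuclideanSpace ℝ ι)) ≤ Real.exp (M.trace + 2 * (M * M).trace) := by
  have heig : ∀ i, hM.eigenvalues i ≤ 1 / 4 := fun i => by
    have h := hle (hM.eigenvectorBasis i).ofLp
    have h1 : (hM.eigenvectorBasis i).ofLp ⬝ᵥ (hM.eigenvectorBasis i).ofLp = 1 := by
      have := hM.eigenvectorBasis.inner_eq_one i
      rw [EuclideanSpace.inner_eq_star_dotProduct] at this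
      simpa using this
    rw [hM.mulVec_eigenvectorBasis, dotProduct_smul, h1] at h
    simpa using h
  have hmeas : Measurable (fun x : ι → ℝ => ∑ i, x i • hM.eigenvectorBasis i) := by fun_prop
  have hcont : Continuous (fun g : EuclideanSpace ℝ ι =>
      Real.exp (g.ofLp ⬝ᵥ M.mulVec g.ofLp)) := by fun_prop
  have hprod : ∀ x : ι → ℝ, Real.exp ((∑ i, x i • hM.eigenvectorBasis i).ofLp ⬝ᵥ
      M.mulVec (∑ i, x i • hM.eigenvectorBasis i).ofLp)
      = ∏ i, Real.exp (hM.eigenvalues i * x i ^ 2) := fun x => by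
    rw [eigenvectorBasis_repr_quadratic, Real.exp_sum]
  rw [stdGaussian_eq_map_pi_orthonormalBasis hM.eigenvectorBasis]
  constructor
  · rw [integrable_map_measure hcont.aestronglyMeasurable hmeas.aemeasurable]
    simp only [Function.comp_def, hprod]
    exact Integrable.fintype_prod (f := fun i y => Real.exp (hM.eigenvalues i * y ^ 2))
      fun i => (integrable_exp_mul_sq_gaussianReal (heig i)).1
  · rw [integral_map hmeas.aemeasurable hcont.aestronglyMeasurable]
    simp only [hprod]
    rw [integral_fintype_prod_eq_prod (f := fun i y => Real.exp (hM.eigenvalues i * y ^ 2)),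
      hM.trace_eq_sum_eigenvalues, trace_sq_eq_sum_eigenvalues hM, Finset.mul_sum]
    simp only [RCLike.ofReal_real_eq_id, id]
    rw [← Finset.sum_add_distrib, Real.exp_sum]
    exact Finset.prod_le_prod (fun i _ => integral_nonneg fun y => (Real.exp_pos _).le)
      fun i _ => (integrable_exp_mul_sq_gaussianReal (heig i)).2

end Gaussian

/-! ### Characteristic functions from four moments -/

section CharacteristicFunction

variable {Ω : Type*} [MeasurableSpace Ω] {P : Measure Ω} [IsProbabilityMeasure P]

lemma integral_quartic {Y : Ω → ℝ} (hY : MemLp Y 4 P) (c₀ c₁ c₂ c₃ c₄ : ℝ) :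
    Integrable (fun ω => c₀ + c₁ * Y ω + c₂ * Y ω ^ 2 + c₃ * Y ω ^ 3 + c₄ * Y ω ^ 4) P ∧
    ∫ ω, (c₀ + c₁ * Y ω + c₂ * Y ω ^ 2 + c₃ * Y ω ^ 3 + c₄ * Y ω ^ 4) ∂P
      = c₀ + c₁ * ∫ ω, Y ω ∂P + c₂ * ∫ ω, Y ω ^ 2 ∂P + c₃ * ∫ ω, Y ω ^ 3 ∂P
        + c₄ * ∫ ω, Y ω ^ 4 ∂P := by
  have h1 : Integrable (fun ω => c₁ * Y ω) P := (hY.integrable (by norm_num)).const_mul _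
  have h2 : Integrable (fun ω => c₂ * Y ω ^ 2) P :=
    (hY.mono_exponent (by norm_num)).integrable_sq.const_mul _
  have h3 : Integrable (fun ω => c₃ * Y ω ^ 3) P := by
    have := (hY.mono_exponent (p := 3) (by norm_num)).integrable_norm_pow (p := 3) (by norm_num)
    exact ((integrable_norm_iff (hY.aestronglyMeasurable.pow 3)).1 (by simpa using this)).const_mul _
  have h4 : Integrable (fun ω => c₄ * Y ω ^ 4) P := by
    have := hY.integrable_norm_pow (p := 4) (by norm_num)
    simp only [Real.norm_eq_abs, Even.pow_abs (by decide : Even 4)] at this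
    exact this.const_mul _
  have h0 : Integrable (fun _ : Ω => c₀) P := integrable_const _
  have h01 : Integrable (fun ω => c₀ + c₁ * Y ω) P := h0.add h1
  have h02 : Integrable (fun ω => c₀ + c₁ * Y ω + c₂ * Y ω ^ 2) P := h01.add h2
  have h03 : Integrable (fun ω => c₀ + c₁ * Y ω + c₂ * Y ω ^ 2 + c₃ * Y ω ^ 3) P := h02.add h3
  refine ⟨h03.add h4, ?_⟩
  rw [integral_add h03 h4, integral_add h02 h3, integral_add h01 h2, integral_add h0 h1]
  simp [integral_const_mul]

lemma sq_integral_sq_le_integral_pow_four {Y : Ω → ℝ} (hY : MemLp Y 4 P) :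
    (∫ ω, Y ω ^ 2 ∂P) ^ 2 ≤ ∫ ω, Y ω ^ 4 ∂P := by
  have h : 0 ≤ ∫ ω, (Y ω ^ 2 - ∫ ω, Y ω ^ 2 ∂P) ^ 2 ∂P := integral_nonneg fun ω => sq_nonneg _
  have e : ∀ ω, (Y ω ^ 2 - ∫ ω, Y ω ^ 2 ∂P) ^ 2
      = (∫ ω, Y ω ^ 2 ∂P) ^ 2 + 0 * Y ω + (-2 * ∫ ω, Y ω ^ 2 ∂P) * Y ω ^ 2 + 0 * Y ω ^ 3
        + 1 * Y ω ^ 4 := fun ω => by ring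
  simp_rw [e] at h
  rw [(integral_quartic hY _ _ _ _ _).2] at h
  linarith

/-- For an independent copy Y', the left side is E cos(Y - Y'), and the quartic bound on cos leaves
1 - m₂ + (2m₄ + 6m₂²)/24 with m₂² ≤ m₄. The odd moments cancel because the mean is zero. Two
successive integrations over P (`inner`, `outer`) replace the copy. -/
lemma norm_sq_integral_cexp_le {Y : Ω → ℝ} (hY : MemLp Y 4 P) (hmean : ∫ ω, Y ω ∂P = 0) :
    ‖∫ ω, Complex.exp (Y ω * Complex.I) ∂P‖ ^ 2
      ≤ 1 - ∫ ω, Y ω ^ 2 ∂P + (∫ ω, Y ω ^ 4 ∂P) / 3 := by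
  have hm := hY.aestronglyMeasurable
  have hc : Integrable (fun ω => Real.cos (Y ω)) P :=
    Integrable.of_bound (Real.continuous_cos.comp_aestronglyMeasurable hm) 1
      (Filter.Eventually.of_forall fun ω => by simpa using Real.abs_cos_le_one _)
  have hs : Integrable (fun ω => Real.sin (Y ω)) P :=
    Integrable.of_bound (Real.continuous_sin.comp_aestronglyMeasurable hm) 1
      (Filter.Eventually.of_forall fun ω => by simpa using Real.abs_sin_le_one _)
  have hcs : ∫ ω, Complex.exp (Y ω * Complex.I) ∂P
      = (∫ ω, Real.cos (Y ω) ∂P : ℝ) + (∫ ω, Real.sin (Y ω) ∂P : ℝ) * Complex.I := by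
    rw [← integral_complex_ofReal, ← integral_complex_ofReal, ← integral_mul_const,
      ← integral_add hc.ofReal (hs.ofReal.mul_const _)]
    simp [Complex.exp_mul_I]
  rw [hcs, ← Complex.normSq_eq_norm_sq, Complex.normSq_add_mul_I]
  set C := ∫ ω, Real.cos (Y ω) ∂P
  set S := ∫ ω, Real.sin (Y ω) ∂P
  set m2 := ∫ ω, Y ω ^ 2 ∂P with hm2
  set m3 := ∫ ω, Y ω ^ 3 ∂P with hm3
  set m4 := ∫ ω, Y ω ^ 4 ∂P with hm4
  have hsq : m2 ^ 2 ≤ m4 := sq_integral_sq_le_integral_pow_four hY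
  have inner : ∀ x : ℝ, Real.cos x * C + Real.sin x * S
      ≤ 1 - (x ^ 2 + m2) / 2 + (x ^ 4 + 6 * x ^ 2 * m2 - 4 * x * m3 + m4) / 24 := fun x => by
    have e1 : Real.cos x * C + Real.sin x * S = ∫ ω, Real.cos (x - Y ω) ∂P := by
      simp_rw [Real.cos_sub]
      rw [integral_add (hc.const_mul _) (hs.const_mul _), integral_const_mul, integral_const_mul]
    have e2 : ∫ ω, Real.cos (x - Y ω) ∂P ≤ ∫ ω, ((1 - x ^ 2 / 2 + x ^ 4 / 24)
        + (x - x ^ 3 / 6) * Y ω + (x ^ 2 / 4 - 1 / 2) * Y ω ^ 2 + (- x / 6) * Y ω ^ 3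
        + (1 / 24) * Y ω ^ 4) ∂P := by
      refine integral_mono (Integrable.of_bound (Real.continuous_cos.comp_aestronglyMeasurable
        (aestronglyMeasurable_const.sub hm)) 1
        (Filter.Eventually.of_forall fun ω => by simpa using Real.abs_cos_le_one _))
        (integral_quartic hY _ _ _ _ _).1 fun ω => ?_
      have := cos_le_quartic (x - Y ω)
      simp only
      linarith
    rw [(integral_quartic hY _ _ _ _ _).2, hmean, ← hm2, ← hm3, ← hm4] at e2
    rw [e1]
    linarith
  have outer : ∫ ω, (Real.cos (Y ω) * C + Real.sin (Y ω) * S) ∂P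
      ≤ ∫ ω, ((1 - m2 / 2 + m4 / 24) + (- m3 / 6) * Y ω
        + (m2 / 4 - 1 / 2) * Y ω ^ 2 + 0 * Y ω ^ 3 + (1 / 24) * Y ω ^ 4) ∂P := by
    refine integral_mono ((hc.mul_const _).add (hs.mul_const _))
      (integral_quartic hY _ _ _ _ _).1 fun ω => ?_
    have := inner (Y ω)
    simp only
    linarith
  rw [integral_add (hc.mul_const _) (hs.mul_const _), integral_mul_const, integral_mul_const,
    (integral_quartic hY _ _ _ _ _).2, hmean, ← hm2, ← hm4] at outer
  nlinarith

end CharacteristicFunction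

/-! ### The Laplace transform of the squared norm of an independent sum -/

section LaplaceTransform

variable {Ω : Type*} [MeasurableSpace Ω] {P : Measure Ω} {ι : Type*}

/-- The matrix of second moments of a random vector indexed by a finite type. -/
noncomputable def momentMatrix (P : Measure Ω) (A : Ω → ι → ℝ) : Matrix ι ι ℝ :=
  Matrix.of fun k l => ∫ ω, A ω k * A ω l ∂P

lemma momentMatrix_isHermitian (A : Ω → ι → ℝ) : (momentMatrix P A).IsHermitian := by
  ext k l
  simp [momentMatrix, mul_comm]

variable [Fintype ι]

lemma sum_integral_eq_integral_dotProduct {A : Ω → ι → ℝ}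
    (hA : ∀ k, MemLp (fun ω => A ω k) 2 P) (M : Matrix ι ι ℝ) :
    Integrable (fun ω => A ω ⬝ᵥ M.mulVec (A ω)) P ∧
    ∫ ω, A ω ⬝ᵥ M.mulVec (A ω) ∂P = ∑ k, ∑ l, M k l * momentMatrix P A k l := by
  have hi : ∀ k l, Integrable (fun ω => M k l * (A ω k * A ω l)) P := fun k l =>
    ((hA k).integrable_mul (hA l)).const_mul _
  have e : ∀ ω, A ω ⬝ᵥ M.mulVec (A ω) = ∑ k, ∑ l, M k l * (A ω k * A ω l) := fun ω => by
    simp only [dotProduct, Matrix.mulVec, Finset.mul_sum]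
    exact Finset.sum_congr rfl fun k _ => Finset.sum_congr rfl fun l _ => by ring
  simp_rw [e]
  refine ⟨integrable_finsetSum _ fun k _ => integrable_finsetSum _ fun l _ => hi k l, ?_⟩
  rw [integral_finsetSum _ fun k _ => integrable_finsetSum _ fun l _ => hi k l]
  refine Finset.sum_congr rfl fun k _ => ?_
  rw [integral_finsetSum _ fun l _ => hi k l]
  simp [integral_const_mul, momentMatrix]

lemma dotProduct_momentMatrix_mulVec {A : Ω → ι → ℝ}
    (hA : ∀ k, MemLp (fun ω => A ω k) 2 P) (v : ι → ℝ) :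
    v ⬝ᵥ (momentMatrix P A).mulVec v = ∫ ω, (v ⬝ᵥ A ω) ^ 2 ∂P := by
  have h := (sum_integral_eq_integral_dotProduct hA (Matrix.vecMulVec v v)).2
  have e : ∀ ω, A ω ⬝ᵥ (Matrix.vecMulVec v v).mulVec (A ω) = (v ⬝ᵥ A ω) ^ 2 := fun ω => by
    rw [Matrix.vecMulVec_mulVec, sq]
    simp [dotProduct_comm]
  simp_rw [e] at h
  rw [h]
  simp only [dotProduct, Matrix.mulVec, Finset.mul_sum, Matrix.vecMulVec_apply]
  exact Finset.sum_congr rfl fun k _ => Finset.sum_congr rfl fun l _ => by ring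

variable [IsProbabilityMeasure P]

lemma norm_pow_integral_cexp_le {A : Ω → ι → ℝ} {B : Matrix ι ι ℝ} {α l : ℝ} {n : ℕ}
    (hn : 0 < n) (hl : 0 ≤ l)
    (h4 : ∀ v : ι → ℝ, MemLp (fun ω => v ⬝ᵥ A ω) 4 P) (hA : ∀ k, MemLp (fun ω => A ω k) 2 P)
    (h0 : ∀ v : ι → ℝ, ∫ ω, v ⬝ᵥ A ω ∂P = 0)
    (hB : ∀ v : ι → ℝ, ∫ ω, (v ⬝ᵥ A ω) ^ 4 ∂P ≤ α ^ 2 * (v ⬝ᵥ B.mulVec v) ^ 2) (v : ι → ℝ) :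
    ‖∫ ω, Complex.exp ((√(2 * l / n) * (v ⬝ᵥ A ω) : ℝ) * Complex.I) ∂P‖ ^ n
      ≤ Real.exp (-l * (v ⬝ᵥ (momentMatrix P A).mulVec v)
        + 2 / 3 * (l ^ 2 / n) * α ^ 2 * (v ⬝ᵥ B.mulVec v) ^ 2) := by
  have hn' : (0 : ℝ) < n := by exact_mod_cast hn
  have hs : √(2 * l / n) ^ 2 = 2 * l / n := Real.sq_sqrt (by positivity)
  have h := norm_sq_integral_cexp_le ((h4 v).const_mul √(2 * l / n))
    (by rw [integral_const_mul, h0, mul_zero])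
  simp_rw [mul_pow] at h
  rw [integral_const_mul, integral_const_mul, ← dotProduct_momentMatrix_mulVec hA,
    show √(2 * l / n) ^ 4 = (√(2 * l / n) ^ 2) ^ 2 by ring, hs] at h
  set φ := ‖∫ ω, Complex.exp ((√(2 * l / n) * (v ⬝ᵥ A ω) : ℝ) * Complex.I) ∂P‖
  have hφ : 0 ≤ φ := norm_nonneg _
  set x := v ⬝ᵥ (momentMatrix P A).mulVec v
  set y := v ⬝ᵥ B.mulVec v
  have h1 : φ ^ 2 ≤ Real.exp (-(2 * l / n * x) + (2 * l / n) ^ 2 * (α ^ 2 * y ^ 2) / 3) := by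
    refine le_trans ?_ (Real.add_one_le_exp _)
    have := mul_le_mul_of_nonneg_left (hB v) (sq_nonneg (2 * l / n))
    linarith
  have h2 := pow_le_pow_left₀ (sq_nonneg φ) h1 n
  rw [← Real.exp_nat_mul] at h2
  refine (pow_le_pow_iff_left₀ (by positivity) (by positivity) two_ne_zero).1 ?_
  rw [← pow_mul, mul_comm n 2, pow_mul, ← Real.exp_nat_mul]
  refine h2.trans_eq ?_
  congr 1
  push_cast
  field_simp

lemma integral_cexp_stdGaussian (y : ι → ℝ) (s : ℝ) :
    ∫ g : EuclideanSpace ℝ ι, Complex.exp ((s * (g.ofLp ⬝ᵥ y) : ℝ) * Complex.I)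
      ∂(stdGaussian (EuclideanSpace ℝ ι)) = Real.exp (-(s ^ 2 / 2) * (y ⬝ᵥ y)) := by
  have h := charFun_stdGaussian (s • WithLp.toLp 2 y : EuclideanSpace ℝ ι)
  rw [charFun_apply] at h
  convert h using 2
  · ext g
    rw [inner_smul_right, EuclideanSpace.inner_eq_star_dotProduct]
    simp [dotProduct_comm]
  · rw [← Complex.ofReal_pow, EuclideanSpace.real_norm_sq_eq]
    push_cast
    simp [dotProduct, Finset.mul_sum, Finset.sum_div, mul_pow, ← Finset.sum_neg_distrib]
    congr 1
    exact Finset.sum_congr rfl fun k _ => by ring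

/-- Gaussian linearisation: the exponential of minus a squared norm averages plane waves in g, and
each plane wave factors over the independent summands. -/
lemma integral_exp_neg_sq_norm_sum_le {n : ℕ} {A : Fin n → Ω → ι → ℝ} {A₀ : Ω → ι → ℝ}
    (hind : iIndepFun A P) (hid : ∀ i, IdentDistrib (A i) A₀ P P) {s : ℝ}
    {G : EuclideanSpace ℝ ι → ℝ} (hG : Integrable G (stdGaussian (EuclideanSpace ℝ ι)))
    (hle : ∀ g : EuclideanSpace ℝ ι,
      ‖∫ ω, Complex.exp ((s * (g.ofLp ⬝ᵥ A₀ ω) : ℝ) * Complex.I) ∂P‖ ^ n ≤ G g) :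
    ∫ ω, Real.exp (-(s ^ 2 / 2) * ((∑ i, A i ω) ⬝ᵥ ∑ i, A i ω)) ∂P
      ≤ ∫ g, G g ∂(stdGaussian (EuclideanSpace ℝ ι)) := by
  have hA : ∀ i, AEMeasurable (A i) P := fun i => (hid i).aemeasurable_fst
  set γ := stdGaussian (EuclideanSpace ℝ ι)
  have hjoint : AEStronglyMeasurable (Function.uncurry fun (ω : Ω) (g : EuclideanSpace ℝ ι) =>
      Complex.exp ((s * (g.ofLp ⬝ᵥ ∑ i, A i ω) : ℝ) * Complex.I)) (P.prod γ) := by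
    have hS : AEMeasurable (fun ω => ∑ i, A i ω) P := by fun_prop
    have hc : Continuous fun p : (ι → ℝ) × EuclideanSpace ℝ ι =>
      Complex.exp ((s * (p.2.ofLp ⬝ᵥ p.1) : ℝ) * Complex.I) := by fun_prop
    exact (hc.measurable.comp_aemeasurable
      ((hS.comp_fst (ν := γ)).prodMk measurable_snd.aemeasurable)).aestronglyMeasurable
  have hexp_int : Integrable (Function.uncurry fun (ω : Ω) (g : EuclideanSpace ℝ ι) =>
      Complex.exp ((s * (g.ofLp ⬝ᵥ ∑ i, A i ω) : ℝ) * Complex.I)) (P.prod γ) :=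
    Integrable.of_bound hjoint 1 (Filter.Eventually.of_forall fun p => by
      simp only [Function.uncurry]; rw [Complex.norm_exp_ofReal_mul_I])
  have hswap := integral_integral_swap hexp_int
  simp only at hswap
  have hfac : ∀ g : EuclideanSpace ℝ ι,
      ∫ ω, Complex.exp ((s * (g.ofLp ⬝ᵥ ∑ i, A i ω) : ℝ) * Complex.I) ∂P
        = (∫ ω, Complex.exp ((s * (g.ofLp ⬝ᵥ A₀ ω) : ℝ) * Complex.I) ∂P) ^ n := fun g => by
    have hf : Continuous fun y : ι → ℝ =>
      Complex.exp ((s * (g.ofLp ⬝ᵥ y) : ℝ) * Complex.I) := by fun_prop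
    have hprod : ∀ ω, Complex.exp ((s * (g.ofLp ⬝ᵥ ∑ i, A i ω) : ℝ) * Complex.I)
        = ∏ i, Complex.exp ((s * (g.ofLp ⬝ᵥ A i ω) : ℝ) * Complex.I) := fun ω => by
      rw [← Complex.exp_sum, dotProduct_sum, Finset.mul_sum, Complex.ofReal_sum, Finset.sum_mul]
    simp_rw [hprod]
    rw [hind.integral_fun_prod_comp (f := fun _ y =>
      Complex.exp ((s * (g.ofLp ⬝ᵥ y) : ℝ) * Complex.I)) hA
      fun i => hf.measurable.aestronglyMeasurable]
    have : ∀ i, ∫ ω, Complex.exp ((s * (g.ofLp ⬝ᵥ A i ω) : ℝ) * Complex.I) ∂P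
        = ∫ ω, Complex.exp ((s * (g.ofLp ⬝ᵥ A₀ ω) : ℝ) * Complex.I) ∂P := fun i =>
      ((hid i).comp hf.measurable).integral_eq
    rw [Finset.prod_congr rfl fun i _ => this i, Finset.prod_const, Finset.card_univ,
      Fintype.card_fin]
  have hgauss : ∀ ω, ∫ g : EuclideanSpace ℝ ι,
      Complex.exp ((s * (g.ofLp ⬝ᵥ ∑ i, A i ω) : ℝ) * Complex.I) ∂γ
        = (Real.exp (-(s ^ 2 / 2) * ((∑ i, A i ω) ⬝ᵥ ∑ i, A i ω)) : ℝ) :=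
    fun ω => integral_cexp_stdGaussian _ _
  simp_rw [hgauss, hfac] at hswap
  rw [integral_complex_ofReal] at hswap
  have h := norm_integral_le_of_norm_le hG (f := fun g : EuclideanSpace ℝ ι =>
    (∫ ω, Complex.exp ((s * (g.ofLp ⬝ᵥ A₀ ω) : ℝ) * Complex.I) ∂P) ^ n)
    (Filter.Eventually.of_forall fun g => by rw [norm_pow]; exact hle g)
  rw [← hswap, Complex.norm_real] at h
  exact (le_abs_self _).trans h

variable [DecidableEq ι]

lemma integral_exp_neg_le_two_mul_exp {n : ℕ} {A : Fin n → Ω → ι → ℝ} {A₀ : Ω → ι → ℝ}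
    {B : Matrix ι ι ℝ} {α l a b : ℝ} (hn : 0 < n) (hl : 0 ≤ l) (hl' : l ≤ 1 / 4) (hα : 0 < α)
    (hind : iIndepFun A P) (hid : ∀ i, IdentDistrib (A i) A₀ P P)
    (h4 : ∀ v : ι → ℝ, MemLp (fun ω => v ⬝ᵥ A₀ ω) 4 P)
    (hA : ∀ k, MemLp (fun ω => A₀ ω k) 2 P)
    (h0 : ∀ v : ι → ℝ, ∫ ω, v ⬝ᵥ A₀ ω ∂P = 0)
    (hB4 : ∀ v : ι → ℝ, ∫ ω, (v ⬝ᵥ A₀ ω) ^ 4 ∂P ≤ α ^ 2 * (v ⬝ᵥ B.mulVec v) ^ 2)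
    (hB : B.PosSemidef) (hB1 : ∀ v : ι → ℝ, v ⬝ᵥ B.mulVec v ≤ v ⬝ᵥ v)
    (hBt : B.trace = a) (hBt2 : (B * B).trace = b ^ 2) (hb : 1 ≤ b) (hba : b ^ 2 ≤ a)
    (hT : (momentMatrix P A₀).trace ≤ a + α * b)
    (hnα : 7 * α ^ 2 * b ^ 2 * (a + α * b) ≤ n) :
    ∫ ω, Real.exp (-l * ((n : ℝ)⁻¹ * ((∑ i, A i ω) ⬝ᵥ ∑ i, A i ω))) ∂P
      ≤ 2 * Real.exp (-l * (momentMatrix P A₀).trace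
        + 8 * l ^ 2 * ((momentMatrix P A₀ * momentMatrix P A₀).trace
          + 15 * α ^ 2 * a * b * (a + α * b) / (4 * n))) := by
  set Q := momentMatrix P A₀ with hQ
  set τ := a + α * b with hτ
  have hn' : (0 : ℝ) < n := by exact_mod_cast hn
  have ha : 1 ≤ a := by nlinarith
  have hτpos : 0 < τ := by positivity
  -- The quartic coefficient 2l²α²/(3n) times the cutoff 4τ.
  obtain ⟨e, he⟩ : ∃ e, e = 8 / 3 * l ^ 2 * α ^ 2 * τ / n := ⟨_, rfl⟩
  have he0 : 0 ≤ e := by rw [he]; positivity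
  have hl2 : l ^ 2 ≤ 1 / 16 := by nlinarith
  -- `hnα` and l² ≤ 1/16 give 1/42. Smallness of e keeps M below 1/4 and makes e²b² negligible
  -- against e a.
  have heb : e * b ^ 2 ≤ 1 / 40 := by
    have h1 : e * b ^ 2 = 8 / 21 * l ^ 2 * (7 * α ^ 2 * b ^ 2 * τ / n) := by
      rw [he]; field_simp; ring
    have h2 : 7 * α ^ 2 * b ^ 2 * τ / n ≤ 1 := (div_le_one hn').2 hnα
    have h3 : 0 ≤ 7 * α ^ 2 * b ^ 2 * τ / n := by positivity
    rw [h1]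
    nlinarith [mul_le_mul hl2 h2 h3 (by norm_num)]
  have hQH : Q.IsHermitian := momentMatrix_isHermitian A₀
  have hQ0 : ∀ v : ι → ℝ, 0 ≤ v ⬝ᵥ Q.mulVec v := fun v => by
    rw [hQ, dotProduct_momentMatrix_mulVec hA]
    exact integral_nonneg fun ω => sq_nonneg _
  have hB0 : ∀ v : ι → ℝ, 0 ≤ v ⬝ᵥ B.mulVec v := fun v => by
    simpa using hB.dotProduct_mulVec_nonneg v
  have hv0 : ∀ v : ι → ℝ, 0 ≤ v ⬝ᵥ v := fun v => (hB0 v).trans (hB1 v)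
  set M : Matrix ι ι ℝ := (-l) • Q + e • B with hM
  have hMq : ∀ v : ι → ℝ, v ⬝ᵥ M.mulVec v = -l * (v ⬝ᵥ Q.mulVec v) + e * (v ⬝ᵥ B.mulVec v) :=
    fun v => by
      rw [hM, Matrix.add_mulVec, Matrix.smul_mulVec, Matrix.smul_mulVec, dotProduct_add,
        dotProduct_smul, dotProduct_smul, smul_eq_mul, smul_eq_mul]
  have hMH : M.IsHermitian := by
    ext k m
    have h1 := hQH.apply k m
    have h2 := hB.isHermitian.apply k m
    simp only [star_trivial] at h1 h2
    simp [hM, h1, h2]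
  have he4 : e ≤ 1 / 4 := by nlinarith
  obtain ⟨iM, bM⟩ := integral_exp_quadratic_stdGaussian hMH fun v => by
    rw [hMq]
    have := hQ0 v
    have := hB1 v
    have := hB0 v
    have := hv0 v
    nlinarith
  have hBH : ((1 / 8 : ℝ) • B).IsHermitian := by
    ext k m
    have h2 := hB.isHermitian.apply k m
    simp only [star_trivial] at h2
    simp [h2]
  have hBq : ∀ v : ι → ℝ, v ⬝ᵥ ((1 / 8 : ℝ) • B).mulVec v = 1 / 8 * (v ⬝ᵥ B.mulVec v) :=
    fun v => by simp [Matrix.smul_mulVec]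
  obtain ⟨iB, bB⟩ := integral_exp_quadratic_stdGaussian hBH fun v => by
    rw [hBq]
    have := hB1 v
    have := hv0 v
    linarith
  have iB' := iB.const_mul (Real.exp (-(τ / 2)))
  have key := integral_exp_neg_sq_norm_sum_le hind hid (s := √(2 * l / n)) (iM.add iB') fun g => by
    rcases le_total (g.ofLp ⬝ᵥ B.mulVec g.ofLp) (4 * τ) with h | h
    · refine (norm_pow_integral_cexp_le hn hl h4 hA h0 hB4 g.ofLp).trans ?_
      refine le_trans ?_ (le_add_of_nonneg_right (by positivity))
      rw [Real.exp_le_exp, hMq]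
      have h5 : (g.ofLp ⬝ᵥ B.mulVec g.ofLp) ^ 2 ≤ 4 * τ * (g.ofLp ⬝ᵥ B.mulVec g.ofLp) := by
        nlinarith [hB0 g.ofLp]
      have h6 : 0 ≤ 2 / 3 * (l ^ 2 / n) * α ^ 2 := by positivity
      have h7 : e = 2 / 3 * (l ^ 2 / n) * α ^ 2 * (4 * τ) := by rw [he]; ring
      have := mul_le_mul_of_nonneg_left h5 h6
      rw [h7]
      linarith
    -- Beyond the cutoff, 1 ≤ exp(gᵀBg/8 - τ/2).
    · have h1 : ‖∫ ω, Complex.exp ((√(2 * l / n) * (g.ofLp ⬝ᵥ A₀ ω) : ℝ) * Complex.I) ∂P‖ ≤ 1 := by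
        refine (norm_integral_le_integral_norm _).trans ?_
        simp_rw [Complex.norm_exp_ofReal_mul_I]
        simp
      refine (pow_le_one₀ (norm_nonneg _) h1).trans ?_
      refine le_trans ?_ (le_add_of_nonneg_left (Real.exp_pos _).le)
      simp only
      rw [← Real.exp_add, Real.one_le_exp_iff, hBq]
      linarith
  have hexp : ∀ ω, -(√(2 * l / n) ^ 2 / 2) * ((∑ i, A i ω) ⬝ᵥ ∑ i, A i ω)
      = -l * ((n : ℝ)⁻¹ * ((∑ i, A i ω) ⬝ᵥ ∑ i, A i ω)) := fun ω => by
    rw [Real.sq_sqrt (by positivity)]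
    field_simp
  simp_rw [hexp] at key
  refine key.trans ?_
  simp only [Pi.add_apply]
  rw [integral_add iM iB', integral_const_mul]
  have hQQ : 0 ≤ (Q * Q).trace := by
    rw [trace_sq_eq_sum_eigenvalues hQH]
    exact Finset.sum_nonneg fun i _ => sq_nonneg _
  have hMM : (M * M).trace ≤ 2 * l ^ 2 * (Q * Q).trace + 2 * e ^ 2 * b ^ 2 := by
    -- Adding Tr (lQ + eB)² ≥ 0 removes the cross term, as in the parallelogram law.
    have hN : (l • Q + e • B).IsHermitian := by
      ext k m
      have h1 := hQH.apply k m
      have h2 := hB.isHermitian.apply k m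
      simp only [star_trivial] at h1 h2
      simp [h1, h2]
    have h1 : 0 ≤ ((l • Q + e • B) * (l • Q + e • B)).trace := by
      rw [trace_sq_eq_sum_eigenvalues hN]
      exact Finset.sum_nonneg fun i _ => sq_nonneg _
    rw [hM]
    simp only [add_mul, mul_add, Matrix.trace_add, smul_mul_assoc, mul_smul_comm,
      Matrix.trace_smul, smul_eq_mul, hBt2] at h1 ⊢
    linarith
  have hRn : 0 ≤ α ^ 2 * a * b * τ / n := by positivity
  have he' : e * a ≤ 8 / 3 * l ^ 2 * (α ^ 2 * a * b * τ / n) := by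
    have h1 : e * a = 8 / 3 * l ^ 2 * (α ^ 2 * a * τ / n) := by rw [he]; ring
    have h2 : α ^ 2 * a * τ / n ≤ α ^ 2 * a * b * τ / n := by
      refine div_le_div_of_nonneg_right ?_ hn'.le
      have : 0 ≤ α ^ 2 * a * τ := by positivity
      nlinarith
    rw [h1]
    exact mul_le_mul_of_nonneg_left h2 (by positivity)
  have hR : 15 * α ^ 2 * a * b * τ / (4 * n) = 15 / 4 * (α ^ 2 * a * b * τ / n) := by
    field_simp
  rw [hR, two_mul]
  set ρ := α ^ 2 * a * b * τ / n
  have hlρ : 0 ≤ l ^ 2 * ρ := by positivity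
  have hlQ : 0 ≤ l ^ 2 * (Q * Q).trace := by positivity
  refine add_le_add (bM.trans (Real.exp_le_exp.2 ?_)) ?_
  · have hMt : M.trace = -l * Q.trace + e * a := by
      simp [hM, Matrix.trace_add, Matrix.trace_smul, hBt]
    have h1 : e ^ 2 * b ^ 2 ≤ 1 / 40 * (e * a) := by
      calc e ^ 2 * b ^ 2 = e * (e * b ^ 2) := by ring
        _ ≤ e * (1 / 40 * a) := mul_le_mul_of_nonneg_left (by linarith) he0
        _ = 1 / 40 * (e * a) := by ring
    rw [hMt]
    clear_value Q τ ρ M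
    clear he hM hMq hBq
    linarith
  · refine (mul_le_mul_of_nonneg_left bB (Real.exp_pos _).le).trans ?_
    rw [← Real.exp_add, Real.exp_le_exp]
    simp only [smul_mul_assoc, mul_smul_comm, Matrix.trace_smul, smul_eq_mul, hBt2, hBt]
    -- The exponent is -τ/2 + a/8 + b²/32 ≤ -τ/4, using b² ≤ a ≤ τ, so it lies below -l Tr Q.
    have h1 : l * Q.trace ≤ τ / 4 := by
      have h3 := mul_le_mul_of_nonneg_left hT hl
      have h4 := mul_le_mul_of_nonneg_right hl' hτpos.le
      linarith
    have h2 : a ≤ τ := by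
      have : 0 ≤ α * b := by positivity
      linarith
    linarith

end LaplaceTransform

/-! ### From the Laplace transform to the lower tail -/

section Chernoff

variable {Ω : Type*} [MeasurableSpace Ω] {P : Measure Ω} [IsProbabilityMeasure P]

lemma measureReal_le_two_mul_exp_neg {W : Ω → ℝ} (hW : AEMeasurable W P) (hW0 : ∀ ω, 0 ≤ W ω)
    {m R t : ℝ} (ht : 0 < t) (hR : 0 ≤ R)
    (hlap : ∀ l : ℝ, 0 ≤ l → l ≤ 1 / 4 →
      ∫ ω, Real.exp (-l * W ω) ∂P ≤ 2 * Real.exp (-l * m + 8 * l ^ 2 * R)) :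
    P.real {ω | W ω ≤ m - 4 * max (2 * t) √(2 * R * t)} ≤ 2 * Real.exp (-t) := by
  set x := 4 * max (2 * t) √(2 * R * t)
  have step : ∀ l : ℝ, 0 ≤ l → l ≤ 1 / 4 → t ≤ l * x - 8 * l ^ 2 * R →
      P.real {ω | W ω ≤ m - x} ≤ 2 * Real.exp (-t) := fun l hl hl' h => by
    have hexp_int : Integrable (fun ω => Real.exp (-l * W ω)) P := by
      refine Integrable.of_bound (Real.measurable_exp.comp_aemeasurable
        (hW.const_mul _)).aestronglyMeasurable 1 (Filter.Eventually.of_forall fun ω => ?_)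
      rw [Real.norm_eq_abs, Real.abs_exp, Real.exp_le_one_iff]
      nlinarith [hW0 ω]
    have h1 := measure_le_le_exp_mul_mgf (m - x) (neg_nonpos.2 hl) hexp_int
    refine h1.trans ((mul_le_mul_of_nonneg_left (hlap l hl hl') (Real.exp_pos _).le).trans ?_)
    rw [mul_left_comm, ← Real.exp_add]
    refine mul_le_mul_of_nonneg_left (Real.exp_le_exp.2 ?_) zero_le_two
    linarith
  -- The unconstrained optimum l = √(2Rt)/(4R) is admissible exactly when 2t ≤ R; otherwise the
  -- endpoint l = 1/4 suffices.
  rcases le_total R (2 * t) with h | h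
  · refine step (1 / 4) (by norm_num) le_rfl ?_
    have : 2 * t ≤ max (2 * t) √(2 * R * t) := le_max_left _ _
    simp only [x]
    linarith
  · have hRpos : 0 < R := by linarith
    have hs : √(2 * R * t) ^ 2 = 2 * R * t := Real.sq_sqrt (by positivity)
    have hs0 : 0 ≤ √(2 * R * t) := Real.sqrt_nonneg _
    have hsR : √(2 * R * t) ≤ R := Real.sqrt_le_iff.2 ⟨hR, by nlinarith⟩
    refine step (√(2 * R * t) / (4 * R)) (by positivity) ?_ ?_
    · rw [div_le_iff₀ (by positivity)]
      linarith
    · have h1 : √(2 * R * t) / (4 * R) * (4 * √(2 * R * t))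
          ≤ √(2 * R * t) / (4 * R) * x :=
        mul_le_mul_of_nonneg_left (mul_le_mul_of_nonneg_left (le_max_right _ _) (by norm_num))
          (by positivity)
      have h2 : √(2 * R * t) / (4 * R) * (4 * √(2 * R * t)) = 2 * t := by
        rw [show √(2 * R * t) / (4 * R) * (4 * √(2 * R * t)) = √(2 * R * t) ^ 2 / R by
          field_simp, hs]
        field_simp
      have h3 : 8 * (√(2 * R * t) / (4 * R)) ^ 2 * R = t := by
        rw [div_pow, hs]
        field_simp
        ring
      linarith

end Chernoff

/-! ### Norms, effective ranks and Kronecker squares -/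

section MatrixFacts

variable {d : ℕ}

lemma frobNorm_sq_eq_sum (A : Matrix (Fin d) (Fin d) ℝ) : frobNorm A ^ 2 = ∑ i, ∑ j, A i j ^ 2 := by
  rw [frobNorm, Matrix.frobenius_norm_def, ← Real.rpow_natCast, ← Real.rpow_mul (by positivity)]
  norm_num

lemma frobNorm_sq_eq_trace (A : Matrix (Fin d) (Fin d) ℝ) :
    frobNorm A ^ 2 = (A.transpose * A).trace := by
  rw [frobNorm_sq_eq_sum, Finset.sum_comm]
  simp [Matrix.trace, Matrix.mul_apply, sq]

section Frobenius
open scoped Matrix.Norms.Frobenius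

lemma frobNorm_nonneg (A : Matrix (Fin d) (Fin d) ℝ) : 0 ≤ frobNorm A := norm_nonneg A

end Frobenius

section Operator
open scoped Matrix.Norms.L2Operator

lemma opNorm_nonneg (A : Matrix (Fin d) (Fin d) ℝ) : 0 ≤ opNorm A := norm_nonneg _

lemma opNorm_sq_eq {A : Matrix (Fin d) (Fin d) ℝ} (hA : A.IsHermitian) :
    opNorm (A ^ 2) = opNorm A ^ 2 := by
  rw [opNorm, opNorm, sq, sq, IsSelfAdjoint.norm_mul_self hA, sq]

lemma opNorm_pow_four_eq {A : Matrix (Fin d) (Fin d) ℝ} (hA : A.IsHermitian) :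
    opNorm (A ^ 4) = opNorm A ^ 4 := by
  rw [show A ^ 4 = (A ^ 2) ^ 2 by rw [← pow_mul], opNorm_sq_eq (hA.pow 2), opNorm_sq_eq hA,
    ← pow_mul]

lemma opNorm_le_frobNorm (A : Matrix (Fin d) (Fin d) ℝ) : opNorm A ≤ frobNorm A := by
  rw [opNorm, Matrix.cstar_norm_def]
  refine ContinuousLinearMap.opNorm_le_bound _ (frobNorm_nonneg A) fun x => ?_
  have hf := frobNorm_nonneg A
  refine (sq_le_sq₀ (norm_nonneg _) (by positivity)).1 ?_
  rw [mul_pow, frobNorm_sq_eq_sum, EuclideanSpace.real_norm_sq_eq, EuclideanSpace.real_norm_sq_eq,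
    Finset.sum_mul]
  exact Finset.sum_le_sum fun i _ =>
    Finset.sum_mul_sq_le_sq_mul_sq Finset.univ (fun j => A i j) x.ofLp

lemma dotProduct_mulVec_le_opNorm (A : Matrix (Fin d) (Fin d) ℝ) (x : Fin d → ℝ) :
    x ⬝ᵥ A.mulVec x ≤ opNorm A * (x ⬝ᵥ x) := by
  have h1 := real_inner_le_norm (WithLp.toLp 2 x : EuclideanSpace ℝ (Fin d))
    (WithLp.toLp 2 (A.mulVec x))
  have h2 : ‖(WithLp.toLp 2 (A.mulVec x) : EuclideanSpace ℝ (Fin d))‖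
      ≤ opNorm A * ‖(WithLp.toLp 2 x : EuclideanSpace ℝ (Fin d))‖ :=
    A.l2_opNorm_mulVec (WithLp.toLp 2 x)
  have h3 : ‖(WithLp.toLp 2 x : EuclideanSpace ℝ (Fin d))‖ ^ 2 = x ⬝ᵥ x := by
    rw [EuclideanSpace.real_norm_sq_eq]
    simp [dotProduct, sq]
  rw [EuclideanSpace.inner_eq_star_dotProduct] at h1
  simp only [star_trivial] at h1
  rw [dotProduct_comm, ← h3]
  have := mul_le_mul_of_nonneg_left h2 (norm_nonneg (WithLp.toLp 2 x : EuclideanSpace ℝ (Fin d)))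
  linarith

end Operator

lemma opNorm_smul_one_sub_posSemidef {S : Matrix (Fin d) (Fin d) ℝ} (hS : S.IsHermitian) :
    (opNorm S • (1 : Matrix (Fin d) (Fin d) ℝ) - S).PosSemidef := by
  refine Matrix.PosSemidef.of_dotProduct_mulVec_nonneg ?_ fun x => ?_
  · exact (Matrix.isHermitian_one.smul (IsSelfAdjoint.all _)).sub hS
  · have := dotProduct_mulVec_le_opNorm S x
    simp only [star_trivial, Matrix.sub_mulVec, Matrix.smul_mulVec, Matrix.one_mulVec,
      dotProduct_sub, dotProduct_smul, smul_eq_mul]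
    linarith

lemma opNorm_sq_le_trace_sq {S : Matrix (Fin d) (Fin d) ℝ} (hS : S.IsHermitian) :
    opNorm S ^ 2 ≤ (S ^ 2).trace := by
  have h := pow_le_pow_left₀ (opNorm_nonneg S) (opNorm_le_frobNorm S) 2
  rw [frobNorm_sq_eq_trace] at h
  have : S.transpose = S := by simpa using hS.eq
  rwa [this, ← sq] at h

-- Take the trace of the positive semidefinite matrix S^{1/2} (‖S‖ I - S) S^{1/2}.
open scoped MatrixOrder in
lemma trace_sq_le_opNorm_mul_trace {S : Matrix (Fin d) (Fin d) ℝ} (hS : S.PosSemidef) :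
    (S ^ 2).trace ≤ opNorm S * S.trace := by
  have hmul : CFC.sqrt S * CFC.sqrt S = S := CFC.sqrt_mul_sqrt_self S hS.nonneg
  have hH : (CFC.sqrt S).conjTranspose = CFC.sqrt S :=
    (Matrix.nonneg_iff_posSemidef.1 (CFC.sqrt_nonneg S)).isHermitian.eq
  have h := ((opNorm_smul_one_sub_posSemidef hS.isHermitian).mul_mul_conjTranspose_same
    (CFC.sqrt S)).trace_nonneg
  rw [hH, Matrix.trace_mul_comm, ← Matrix.mul_assoc, hmul] at h
  simp only [Matrix.mul_sub, Matrix.trace_sub, Matrix.mul_smul, Matrix.mul_one,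
    Matrix.trace_smul, smul_eq_mul] at h
  rw [sq]
  linarith

lemma vec_dotProduct_kronecker_mulVec_vec (G H V W : Matrix (Fin d) (Fin d) ℝ) :
    V.vec ⬝ᵥ (H ⊗ₖ G).mulVec W.vec = (V.transpose * G * W * H.transpose).trace := by
  rw [Matrix.kronecker_mulVec_vec, Matrix.vec_dotProduct_vec]
  simp [Matrix.mul_assoc]

/-- The normalised tensor square of a covariance matrix. -/
noncomputable def tensorSq (S : Matrix (Fin d) (Fin d) ℝ) :
    Matrix (Fin d × Fin d) (Fin d × Fin d) ℝ := ((opNorm S ^ 2)⁻¹) • (S ⊗ₖ S)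

lemma tensorSq_posSemidef {S : Matrix (Fin d) (Fin d) ℝ} (hS : S.PosSemidef) :
    (tensorSq S).PosSemidef :=
  (hS.kronecker hS).smul (by positivity)

lemma dotProduct_tensorSq_mulVec_le {S : Matrix (Fin d) (Fin d) ℝ} (hS : S.PosSemidef)
    (hpos : 0 < opNorm S) (v : Fin d × Fin d → ℝ) : v ⬝ᵥ (tensorSq S).mulVec v ≤ v ⬝ᵥ v := by
  have h1 := opNorm_smul_one_sub_posSemidef hS.isHermitian
  have h2 : (opNorm S • (1 : Matrix (Fin d) (Fin d) ℝ)).PosSemidef :=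
    Matrix.PosSemidef.one.smul hpos.le
  -- A telescoping identity that writes ‖S‖² I - S ⊗ S as a sum of Kronecker products of positive
  -- semidefinite factors.
  have e : (opNorm S • (1 : Matrix (Fin d) (Fin d) ℝ) - S) ⊗ₖ (opNorm S • 1)
      + S ⊗ₖ (opNorm S • (1 : Matrix (Fin d) (Fin d) ℝ) - S)
      = (opNorm S ^ 2) • (1 : Matrix (Fin d × Fin d) (Fin d × Fin d) ℝ) - S ⊗ₖ S := by
    rw [← Matrix.one_kronecker_one]
    ext p q
    simp only [Matrix.add_apply, Matrix.sub_apply, Matrix.smul_apply, Matrix.kroneckerMap_apply,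
      smul_eq_mul]
    ring
  have h := ((h1.kronecker h2).add (hS.kronecker h1)).dotProduct_mulVec_nonneg v
  rw [e] at h
  simp only [star_trivial, Matrix.sub_mulVec, Matrix.smul_mulVec, Matrix.one_mulVec,
    dotProduct_sub, dotProduct_smul, smul_eq_mul, tensorSq] at h ⊢
  rw [inv_mul_le_iff₀ (by positivity)]
  linarith

lemma trace_tensorSq (S : Matrix (Fin d) (Fin d) ℝ) : (tensorSq S).trace = effRank S ^ 2 := by
  rw [tensorSq, Matrix.trace_smul, Matrix.trace_kronecker, effRank, smul_eq_mul]
  ring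

lemma trace_tensorSq_mul_self {S : Matrix (Fin d) (Fin d) ℝ} (hS : S.IsHermitian) :
    (tensorSq S * tensorSq S).trace = effRank (S ^ 2) ^ 2 := by
  rw [tensorSq, Matrix.smul_mul, Matrix.mul_smul, ← Matrix.mul_kronecker_mul, Matrix.trace_smul,
    Matrix.trace_smul, Matrix.trace_kronecker, effRank, opNorm_sq_eq hS, smul_eq_mul, smul_eq_mul,
    ← sq S]
  ring

lemma one_le_effRank_sq {S : Matrix (Fin d) (Fin d) ℝ} (hS : S.IsHermitian)
    (hpos : 0 < opNorm S) : 1 ≤ effRank (S ^ 2) := by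
  rw [effRank, opNorm_sq_eq hS, one_le_div (by positivity)]
  exact opNorm_sq_le_trace_sq hS

lemma effRank_sq_le {S : Matrix (Fin d) (Fin d) ℝ} (hS : S.PosSemidef) (hpos : 0 < opNorm S) :
    effRank (S ^ 2) ≤ effRank S := by
  rw [effRank, effRank, opNorm_sq_eq hS.isHermitian, div_le_div_iff₀ (by positivity) hpos]
  have := mul_le_mul_of_nonneg_right (trace_sq_le_opNorm_mul_trace hS) hpos.le
  linarith

lemma quadForm_eq_trace (V : Matrix (Fin d) (Fin d) ℝ) (x : Fin d → ℝ) :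
    quadForm V x = (V * Matrix.vecMulVec x x).trace := by
  rw [Matrix.mul_vecMulVec, Matrix.trace_vecMulVec, quadForm, dotProduct_comm]

open scoped MatrixOrder in
lemma quadForm_eq_quadForm_whiten {S : Matrix (Fin d) (Fin d) ℝ} (hS : S.PosSemidef)
    (hu : IsUnit S) (V : Matrix (Fin d) (Fin d) ℝ) (x : Fin d → ℝ) :
    quadForm V x = quadForm (CFC.sqrt S * V * CFC.sqrt S) (whiten S x) := by
  have hmul : CFC.sqrt S * CFC.sqrt S = S := CFC.sqrt_mul_sqrt_self S hS.nonneg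
  have hR : IsUnit (CFC.sqrt S).det := by
    have h := (Matrix.isUnit_iff_isUnit_det _).1 hu
    rw [← hmul, Matrix.det_mul] at h
    exact isUnit_of_mul_isUnit_left h
  have hT : (CFC.sqrt S).transpose = CFC.sqrt S := by
    simpa using (Matrix.nonneg_iff_posSemidef.1 (CFC.sqrt_nonneg S)).isHermitian.eq
  have hx : (CFC.sqrt S).mulVec (whiten S x) = x := by
    rw [whiten, Matrix.mulVec_mulVec, Matrix.mul_nonsing_inv _ hR, Matrix.one_mulVec]
  rw [quadForm, quadForm, ← Matrix.mulVec_mulVec, ← Matrix.mulVec_mulVec, hx,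
    Matrix.dotProduct_mulVec (whiten S x), ← Matrix.mulVec_transpose, hT, hx]

-- Turns the Frobenius norm in the fourth-moment condition, stated for the whitened vector, into a
-- Kronecker form in the original test matrix.
open scoped MatrixOrder in
lemma frobNorm_sqrt_mul_mul_sqrt_sq {S : Matrix (Fin d) (Fin d) ℝ} (hS : S.PosSemidef)
    (V : Matrix (Fin d) (Fin d) ℝ) :
    frobNorm (CFC.sqrt S * V * CFC.sqrt S) ^ 2 = V.vec ⬝ᵥ (S ⊗ₖ S).mulVec V.vec := by
  have hmul : CFC.sqrt S * CFC.sqrt S = S := CFC.sqrt_mul_sqrt_self S hS.nonneg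
  have hT : (CFC.sqrt S).transpose = CFC.sqrt S := by
    simpa using (Matrix.nonneg_iff_posSemidef.1 (CFC.sqrt_nonneg S)).isHermitian.eq
  have hST : S.transpose = S := by simpa using hS.isHermitian.eq
  rw [frobNorm_sq_eq_trace, vec_dotProduct_kronecker_mulVec_vec, hST]
  simp only [Matrix.transpose_mul, hT]
  conv_rhs => rw [← hmul]
  rw [Matrix.mul_assoc, Matrix.trace_mul_comm]
  simp only [Matrix.mul_assoc]

end MatrixFacts

/-! ### Mean squared norm of a sum of independent vectors -/

section SumOfIndependent

variable {Ω : Type*} [MeasurableSpace Ω] {P : Measure Ω} [IsProbabilityMeasure P]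
  {ι : Type*} [Fintype ι]

lemma integral_sum_dotProduct_sum {n : ℕ} {A : Fin n → Ω → ι → ℝ} {A₀ : Ω → ι → ℝ}
    (hind : iIndepFun A P) (hid : ∀ i, IdentDistrib (A i) A₀ P P)
    (hA : ∀ k, MemLp (fun ω => A₀ ω k) 2 P) (h0 : ∀ k, ∫ ω, A₀ ω k ∂P = 0) :
    Integrable (fun ω => (∑ i, A i ω) ⬝ᵥ ∑ i, A i ω) P ∧
      ∫ ω, (∑ i, A i ω) ⬝ᵥ ∑ i, A i ω ∂P = n * (momentMatrix P A₀).trace := by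
  have hidk : ∀ i k, IdentDistrib (fun ω => A i ω k) (fun ω => A₀ ω k) P P := fun i k =>
    (hid i).comp (measurable_pi_apply k)
  have hAi : ∀ i k, MemLp (fun ω => A i ω k) 2 P := fun i k => (hidk i k).memLp_iff.2 (hA k)
  have hsum : ∀ k, MemLp (∑ i, fun ω => A i ω k) 2 P := fun k =>
    memLp_finsetSum' _ fun i _ => hAi i k
  have e : ∀ ω, (∑ i, A i ω) ⬝ᵥ ∑ i, A i ω = ∑ k, (∑ i, fun ω => A i ω k) ω ^ 2 := fun ω => by
    simp [dotProduct, sq]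
  simp_rw [e]
  refine ⟨integrable_finsetSum _ fun k _ => (hsum k).integrable_sq, ?_⟩
  rw [integral_finsetSum _ fun k _ => (hsum k).integrable_sq, Matrix.trace, Finset.mul_sum]
  refine Finset.sum_congr rfl fun k _ => ?_
  have hm : ∀ i, ∫ ω, A i ω k ∂P = 0 := fun i => (hidk i k).integral_eq.trans (h0 k)
  have hm' : ∫ ω, (∑ i, fun ω => A i ω k) ω ∂P = 0 := by
    simp only [Finset.sum_apply]
    rw [integral_finsetSum _ fun i _ => (hAi i k).integrable (by norm_num)]
    simp [hm]
  have hv := IndepFun.variance_sum (μ := P) (X := fun i ω => A i ω k) (s := Finset.univ)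
    (fun i _ => hAi i k) fun i _ j _ hij =>
      (hind.indepFun hij).comp (measurable_pi_apply k) (measurable_pi_apply k)
  rw [variance_of_integral_eq_zero (hsum k).aemeasurable hm'] at hv
  have hv' : ∀ i, variance (fun ω => A i ω k) P = momentMatrix P A₀ k k := fun i => by
    rw [variance_of_integral_eq_zero (hAi i k).aemeasurable (hm i)]
    have := ((hidk i k).comp (measurable_id.pow_const 2)).integral_eq
    simpa [Function.comp_def, momentMatrix, sq] using this
  simp_rw [hv'] at hv
  simpa using hv

end SumOfIndependent

/-! ### Moments of the centred tensor square -/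

section QuadraticForms

variable {d : ℕ}

/-- The vectorised and normalised centred tensor square of an observation. -/
noncomputable def centredVec (S : Matrix (Fin d) (Fin d) ℝ) (x : Fin d → ℝ) : Fin d × Fin d → ℝ :=
  ((opNorm S)⁻¹ • (Matrix.vecMulVec x x - S)).vec

lemma measurable_centredVec (S : Matrix (Fin d) (Fin d) ℝ) : Measurable (centredVec S) := by
  refine measurable_pi_lambda _ fun p => ?_
  simp only [centredVec, Matrix.vec, Matrix.smul_apply, Matrix.sub_apply, Matrix.vecMulVec_apply]
  fun_prop

lemma quadForm_transpose (V : Matrix (Fin d) (Fin d) ℝ) (x : Fin d → ℝ) :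
    quadForm V.transpose x = quadForm V x := by
  rw [quadForm, quadForm, Matrix.mulVec_transpose, dotProduct_comm, Matrix.dotProduct_mulVec]

lemma vec_dotProduct_centredVec (S V : Matrix (Fin d) (Fin d) ℝ) (x : Fin d → ℝ) :
    V.vec ⬝ᵥ centredVec S x
      = (opNorm S)⁻¹ * (quadForm V x - (V.transpose * S).trace) := by
  rw [centredVec, Matrix.vec_dotProduct_vec, Matrix.mul_smul, Matrix.trace_smul, Matrix.mul_sub,
    Matrix.trace_sub, ← quadForm_eq_trace, quadForm_transpose, smul_eq_mul]

lemma centredVec_dotProduct_kronecker_mulVec {S G : Matrix (Fin d) (Fin d) ℝ}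
    (hS : S.IsHermitian) (hG : G.IsHermitian) (x : Fin d → ℝ) :
    centredVec S x ⬝ᵥ (G ⊗ₖ G).mulVec (centredVec S x)
      = (opNorm S ^ 2)⁻¹ * (quadForm G x ^ 2 - 2 * quadForm (G * S * G) x
        + (G * S * (G * S)).trace) := by
  have hST : S.transpose = S := by simpa using hS.eq
  have hGT : G.transpose = G := by simpa using hG.eq
  have h1 : (Matrix.vecMulVec x x * G * Matrix.vecMulVec x x * G).trace = quadForm G x ^ 2 := by
    rw [Matrix.vecMulVec_mul, Matrix.vecMulVec_mul_vecMulVec, Matrix.vecMulVec_mul,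
      Matrix.trace_vecMulVec, Matrix.smul_vecMul, dotProduct_smul, smul_eq_mul,
      ← Matrix.dotProduct_mulVec, dotProduct_comm x (Matrix.vecMul x G),
      ← Matrix.dotProduct_mulVec, quadForm, sq]
  have h2 : (Matrix.vecMulVec x x * G * S * G).trace = quadForm (G * S * G) x := by
    rw [quadForm_eq_trace, Matrix.trace_mul_comm (G * S * G)]
    simp only [Matrix.mul_assoc]
  have h3 : (S * G * Matrix.vecMulVec x x * G).trace = quadForm (G * S * G) x := by
    rw [quadForm_eq_trace, Matrix.trace_mul_comm]
    simp only [Matrix.mul_assoc]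
  have h4 : (S * G * S * G).trace = (G * S * (G * S)).trace := by
    rw [Matrix.trace_mul_comm]
    simp only [Matrix.mul_assoc]
  rw [centredVec, vec_dotProduct_kronecker_mulVec_vec]
  simp only [Matrix.transpose_smul, Matrix.transpose_sub, Matrix.transpose_vecMulVec, hST, hGT,
    Matrix.smul_mul, Matrix.mul_smul, Matrix.trace_smul, smul_eq_mul, Matrix.sub_mul,
    Matrix.mul_sub, Matrix.trace_sub, h1, h2, h3, h4]
  ring

lemma frobNorm_sampleCov_sub_sq {n : ℕ} (hn : 0 < n) {S : Matrix (Fin d) (Fin d) ℝ}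
    (hpos : 0 < opNorm S) (x : Fin n → Fin d → ℝ) :
    frobNorm (sampleCov x - S) ^ 2 = opNorm S ^ 2 / n
      * ((n : ℝ)⁻¹ * ((∑ i, centredVec S (x i)) ⬝ᵥ ∑ i, centredVec S (x i))) := by
  have hn' : (n : ℝ) ≠ 0 := by exact_mod_cast hn.ne'
  have e : ∑ i, centredVec S (x i) = ((opNorm S)⁻¹ * n) • (sampleCov x - S).vec := by
    have h : ∑ i, (Matrix.vecMulVec (x i) (x i) - S) = (n : ℝ) • (sampleCov x - S) := by
      rw [smul_sub, sampleCov, smul_smul, mul_inv_cancel₀ hn', one_smul, Finset.sum_sub_distrib]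
      simp [← Nat.cast_smul_eq_nsmul ℝ]
    simp only [centredVec, ← Matrix.vec_sum, ← Matrix.vec_smul]
    rw [← Finset.smul_sum, h, smul_smul]
  rw [e, smul_dotProduct, dotProduct_smul, Matrix.vec_dotProduct_vec, ← frobNorm_sq_eq_trace,
    smul_eq_mul, smul_eq_mul]
  field_simp

variable {Ω : Type*} [MeasurableSpace Ω] {P : Measure Ω}
  {X₀ : Ω → Fin d → ℝ} {S : Matrix (Fin d) (Fin d) ℝ} {α : ℝ}

lemma integral_quadForm (hX : ∀ k, MemLp (fun ω => X₀ ω k) 2 P) (hS : secondMoment P X₀ = S)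
    (V : Matrix (Fin d) (Fin d) ℝ) :
    Integrable (fun ω => quadForm V (X₀ ω)) P ∧
      ∫ ω, quadForm V (X₀ ω) ∂P = (V.transpose * S).trace := by
  obtain ⟨h1, h2⟩ := sum_integral_eq_integral_dotProduct hX V
  refine ⟨h1, h2.trans ?_⟩
  rw [← hS]
  simp only [Matrix.trace, Matrix.diag, Matrix.mul_apply, Matrix.transpose_apply]
  rw [Finset.sum_comm]
  rfl

lemma posSemidef_of_secondMoment (hX : ∀ k, MemLp (fun ω => X₀ ω k) 2 P)
    (hS : secondMoment P X₀ = S) : S.PosSemidef := by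
  have hS' : momentMatrix P X₀ = S := hS
  rw [← hS']
  refine Matrix.PosSemidef.of_dotProduct_mulVec_nonneg (momentMatrix_isHermitian X₀) fun x => ?_
  rw [star_trivial, dotProduct_momentMatrix_mulVec hX]
  exact integral_nonneg fun ω => sq_nonneg _

variable [IsProbabilityMeasure P]

open scoped MatrixOrder in
lemma memLp_four_vec_dotProduct_centredVec (hX : ∀ k, MemLp (fun ω => X₀ ω k) 2 P)
    (hS : secondMoment P X₀ = S) (hu : IsUnit S)
    (hα : FourthMomentCondition P (fun ω => whiten S (X₀ ω)) α)
    (V : Matrix (Fin d) (Fin d) ℝ) :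
    MemLp (fun ω => V.vec ⬝ᵥ centredVec S (X₀ ω)) 4 P ∧
      ∫ ω, V.vec ⬝ᵥ centredVec S (X₀ ω) ∂P = 0 ∧
      ∫ ω, (V.vec ⬝ᵥ centredVec S (X₀ ω)) ^ 4 ∂P
        ≤ α ^ 2 * (V.vec ⬝ᵥ (tensorSq S).mulVec V.vec) ^ 2 := by
  have hps := posSemidef_of_secondMoment hX hS
  obtain ⟨hi, hm⟩ := integral_quadForm hX hS V
  obtain ⟨h1, h2⟩ := hα.2 (CFC.sqrt S * V * CFC.sqrt S)
  simp only [← quadForm_eq_quadForm_whiten hps hu, hm] at h1 h2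
  rw [show frobNorm (CFC.sqrt S * V * CFC.sqrt S) ^ 4
    = (frobNorm (CFC.sqrt S * V * CFC.sqrt S) ^ 2) ^ 2 by ring,
    frobNorm_sqrt_mul_mul_sqrt_sq hps] at h2
  simp only [vec_dotProduct_centredVec]
  have h4 : MemLp (fun ω => quadForm V (X₀ ω) - (V.transpose * S).trace) 4 P := by
    refine (integrable_norm_rpow_iff (p := 4) (f := fun ω => quadForm V (X₀ ω)
      - (V.transpose * S).trace) (hi.aestronglyMeasurable.sub aestronglyMeasurable_const)
      (by norm_num) (by norm_num)).1 (h1.congr (Filter.Eventually.of_forall fun ω => ?_))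
    simp only [Real.norm_eq_abs]
    rw [show (4 : ENNReal).toReal = ((4 : ℕ) : ℝ) by norm_num, Real.rpow_natCast,
      Even.pow_abs (by decide)]
  refine ⟨h4.const_mul _, ?_, ?_⟩
  · rw [integral_const_mul, integral_sub hi (integrable_const _), hm]
    simp
  · simp only [mul_pow, tensorSq, Matrix.smul_mulVec, dotProduct_smul, smul_eq_mul]
    rw [integral_const_mul]
    have := mul_le_mul_of_nonneg_left h2 (show (0 : ℝ) ≤ (opNorm S)⁻¹ ^ 4 by
      have := opNorm_nonneg S; positivity)
    refine this.trans_eq ?_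
    ring

lemma integral_sq_dotProduct_centredVec_le (hX : ∀ k, MemLp (fun ω => X₀ ω k) 2 P)
    (hS : secondMoment P X₀ = S) (hu : IsUnit S)
    (hα : FourthMomentCondition P (fun ω => whiten S (X₀ ω)) α)
    (v : Fin d × Fin d → ℝ) :
    ∫ ω, (v ⬝ᵥ centredVec S (X₀ ω)) ^ 2 ∂P ≤ α * (v ⬝ᵥ (tensorSq S).mulVec v) := by
  obtain ⟨V, rfl⟩ := Matrix.vec_bijective.surjective v
  obtain ⟨h4, -, hle⟩ := memLp_four_vec_dotProduct_centredVec hX hS hu hα V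
  have hB := (tensorSq_posSemidef (posSemidef_of_secondMoment hX hS)).dotProduct_mulVec_nonneg V.vec
  rw [star_trivial] at hB
  refine le_of_sq_le_sq ?_ (mul_nonneg hα.1.le hB)
  rw [mul_pow]
  exact (sq_integral_sq_le_integral_pow_four h4).trans hle

lemma memLp_two_centredVec (hX : ∀ k, MemLp (fun ω => X₀ ω k) 2 P)
    (hS : secondMoment P X₀ = S) (hu : IsUnit S)
    (hα : FourthMomentCondition P (fun ω => whiten S (X₀ ω)) α)
    (p : Fin d × Fin d) :
    MemLp (fun ω => centredVec S (X₀ ω) p) 2 P ∧ ∫ ω, centredVec S (X₀ ω) p ∂P = 0 := by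
  obtain ⟨V, hV⟩ := Matrix.vec_bijective.surjective (Pi.single p (1 : ℝ))
  obtain ⟨h4, h0, -⟩ := memLp_four_vec_dotProduct_centredVec hX hS hu hα V
  simp only [hV, single_one_dotProduct] at h4 h0
  exact ⟨h4.mono_exponent (by norm_num), h0⟩

/-- With q = xᵀGx and c = Tr (GSGS), the integrand times ‖S‖² has mean E q² - 2c + c = (E q)² + Var
q - c. The variance is at most αc, and the final -c is dropped. G = I controls Tr Q and G = S
controls Tr Q². -/
lemma integral_centredVec_kronecker_le (hX : ∀ k, MemLp (fun ω => X₀ ω k) 2 P)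
    (hS : secondMoment P X₀ = S) (hu : IsUnit S)
    (hα : FourthMomentCondition P (fun ω => whiten S (X₀ ω)) α)
    (hpos : 0 < opNorm S) {G : Matrix (Fin d) (Fin d) ℝ}
    (hG : G.IsHermitian) :
    ∫ ω, centredVec S (X₀ ω) ⬝ᵥ (G ⊗ₖ G).mulVec (centredVec S (X₀ ω)) ∂P
      ≤ (opNorm S ^ 2)⁻¹ * ((G * S).trace ^ 2 + α * (G * S * (G * S)).trace) := by
  have hps := posSemidef_of_secondMoment hX hS
  have hST : S.transpose = S := by simpa using hps.isHermitian.eq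
  have hGT : G.transpose = G := by simpa using hG.eq
  obtain ⟨h4, h0, -⟩ := memLp_four_vec_dotProduct_centredVec hX hS hu hα G
  have hsq := integral_sq_dotProduct_centredVec_le hX hS hu hα G.vec
  obtain ⟨hi, hm⟩ := integral_quadForm hX hS (G * S * G)
  set σ := opNorm S with hσ
  set m := (G * S).trace with hmG
  set c := (G * S * (G * S)).trace with hc
  have hc' : G.vec ⬝ᵥ (S ⊗ₖ S).mulVec G.vec = c := by
    rw [vec_dotProduct_kronecker_mulVec_vec, hGT, hST, hc]
    simp only [Matrix.mul_assoc]
  have hc0 : 0 ≤ c := by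
    rw [← hc']
    simpa using (hps.kronecker hps).dotProduct_mulVec_nonneg G.vec
  have hm' : ((G * S * G).transpose * S).trace = c := by
    simp only [Matrix.transpose_mul, hGT, hST, hc, Matrix.mul_assoc]
  rw [hm'] at hm
  have e : ∀ ω, centredVec S (X₀ ω) ⬝ᵥ (G ⊗ₖ G).mulVec (centredVec S (X₀ ω))
      = (σ ^ 2)⁻¹ * (m ^ 2 + c) + 2 * m / σ * (G.vec ⬝ᵥ centredVec S (X₀ ω))
        + (G.vec ⬝ᵥ centredVec S (X₀ ω)) ^ 2
        + -(2 * (σ ^ 2)⁻¹) * quadForm (G * S * G) (X₀ ω) := fun ω => by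
    rw [centredVec_dotProduct_kronecker_mulVec hps.isHermitian hG, vec_dotProduct_centredVec, hGT,
      ← hσ, ← hmG, ← hc]
    have : σ ≠ 0 := hpos.ne'
    field_simp
    ring
  simp_rw [e]
  have i1 : Integrable (fun ω => 2 * m / σ * (G.vec ⬝ᵥ centredVec S (X₀ ω))) P :=
    (h4.integrable (by norm_num)).const_mul _
  have i2 : Integrable (fun ω => (G.vec ⬝ᵥ centredVec S (X₀ ω)) ^ 2) P :=
    (h4.mono_exponent (by norm_num)).integrable_sq
  have i4 : Integrable (fun ω => (σ ^ 2)⁻¹ * (m ^ 2 + c)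
      + 2 * m / σ * (G.vec ⬝ᵥ centredVec S (X₀ ω)) + (G.vec ⬝ᵥ centredVec S (X₀ ω)) ^ 2) P :=
    ((integrable_const _).add i1).add i2
  have i3 : Integrable (fun ω => (σ ^ 2)⁻¹ * (m ^ 2 + c)
      + 2 * m / σ * (G.vec ⬝ᵥ centredVec S (X₀ ω))) P := (integrable_const _).add i1
  rw [integral_add i4 (hi.const_mul _), integral_add i3 i2,
    integral_add (integrable_const _) i1, integral_const_mul (2 * m / σ),
    integral_const_mul (-(2 * (σ ^ 2)⁻¹)), h0, hm]
  simp only [tensorSq, Matrix.smul_mulVec, dotProduct_smul, smul_eq_mul, hc'] at hsq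
  have : 0 ≤ (σ ^ 2)⁻¹ * c := by positivity
  simp only [integral_const, probReal_univ, one_smul]
  linarith

lemma trace_momentMatrix_centredVec_le (hX : ∀ k, MemLp (fun ω => X₀ ω k) 2 P)
    (hS : secondMoment P X₀ = S) (hu : IsUnit S)
    (hα : FourthMomentCondition P (fun ω => whiten S (X₀ ω)) α)
    (hpos : 0 < opNorm S) :
    (momentMatrix P fun ω => centredVec S (X₀ ω)).trace
      ≤ effRank S ^ 2 + α * effRank (S ^ 2) := by
  have hps := posSemidef_of_secondMoment hX hS
  have h := integral_centredVec_kronecker_le hX hS hu hα hpos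
    (Matrix.isHermitian_one (n := Fin d) (α := ℝ))
  rw [Matrix.one_kronecker_one, (sum_integral_eq_integral_dotProduct
    (fun p => (memLp_two_centredVec hX hS hu hα p).1) 1).2] at h
  have e : ∑ k, ∑ l, (1 : Matrix (Fin d × Fin d) (Fin d × Fin d) ℝ) k l
      * momentMatrix P (fun ω => centredVec S (X₀ ω)) k l
      = (momentMatrix P fun ω => centredVec S (X₀ ω)).trace := by
    simp [Matrix.one_apply, Matrix.trace]
  rw [e, Matrix.one_mul, ← sq S] at h
  refine h.trans_eq ?_
  rw [effRank, effRank, opNorm_sq_eq hps.isHermitian]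
  ring

/-- The variance bound says Q ≤ αB in the Loewner order. Evaluating αB - Q at the random vector
itself and integrating gives Tr Q² ≤ α Tr (BQ). -/
lemma trace_momentMatrix_centredVec_mul_self_le (hX : ∀ k, MemLp (fun ω => X₀ ω k) 2 P)
    (hS : secondMoment P X₀ = S) (hu : IsUnit S)
    (hα : FourthMomentCondition P (fun ω => whiten S (X₀ ω)) α)
    (hpos : 0 < opNorm S) :
    ((momentMatrix P fun ω => centredVec S (X₀ ω))
      * (momentMatrix P fun ω => centredVec S (X₀ ω))).trace
      ≤ α * effRank (S ^ 2) ^ 2 + α ^ 2 * effRank (S ^ 4) := by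
  have hps := posSemidef_of_secondMoment hX hS
  have hmem := fun p => (memLp_two_centredVec hX hS hu hα p).1
  set Q := momentMatrix P fun ω => centredVec S (X₀ ω) with hQ
  have h := integral_centredVec_kronecker_le hX hS hu hα hpos hps.isHermitian
  have h1 : 0 ≤ ∫ ω, centredVec S (X₀ ω) ⬝ᵥ (α • tensorSq S - Q).mulVec (centredVec S (X₀ ω)) ∂P :=
    integral_nonneg fun ω => by
      have := integral_sq_dotProduct_centredVec_le hX hS hu hα (centredVec S (X₀ ω))
      rw [← dotProduct_momentMatrix_mulVec hmem, ← hQ] at this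
      simp only [Pi.zero_apply, Matrix.sub_mulVec, Matrix.smul_mulVec, dotProduct_sub,
        dotProduct_smul, smul_eq_mul]
      linarith
  rw [(sum_integral_eq_integral_dotProduct hmem _).2, ← hQ] at h1
  rw [(sum_integral_eq_integral_dotProduct hmem _).2, ← hQ] at h
  have h2 : (Q * Q).trace = ∑ k, ∑ l, Q k l * Q k l := by
    simp only [Matrix.trace, Matrix.diag, Matrix.mul_apply]
    refine Finset.sum_congr rfl fun k _ => Finset.sum_congr rfl fun l _ => ?_
    congr 1
    simpa using (momentMatrix_isHermitian (P := P) fun ω => centredVec S (X₀ ω)).apply k l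
  have h3 : ∑ k, ∑ l, (α • tensorSq S - Q) k l * Q k l
      = α * (opNorm S ^ 2)⁻¹ * (∑ k, ∑ l, (S ⊗ₖ S) k l * Q k l) - ∑ k, ∑ l, Q k l * Q k l := by
    rw [Finset.mul_sum, ← Finset.sum_sub_distrib]
    refine Finset.sum_congr rfl fun k _ => ?_
    rw [Finset.mul_sum, ← Finset.sum_sub_distrib]
    refine Finset.sum_congr rfl fun l _ => ?_
    simp only [tensorSq, Matrix.sub_apply, Matrix.smul_apply, smul_eq_mul]
    ring
  rw [h3] at h1
  have h4 := mul_le_mul_of_nonneg_left h (show 0 ≤ α * (opNorm S ^ 2)⁻¹ by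
    have := hα.1; positivity)
  rw [h2]
  refine (sub_nonneg.1 h1).trans (h4.trans_eq ?_)
  rw [effRank, effRank, opNorm_sq_eq hps.isHermitian, opNorm_pow_four_eq hps.isHermitian,
    show S ^ 4 = S * S * (S * S) by
      simp only [pow_succ, pow_zero, one_mul, Matrix.mul_assoc], sq S]
  ring

end QuadraticForms

/-! ### Assembly of the theorem -/

open scoped Matrix.Norms.L2Operator in
lemma opNorm_pos_of_isUnit {d : ℕ} (hd : 0 < d) {S : Matrix (Fin d) (Fin d) ℝ} (hu : IsUnit S) :
    0 < opNorm S := by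
  have : Nonempty (Fin d) := ⟨⟨0, hd⟩⟩
  rw [opNorm, norm_pos_iff]
  exact hu.ne_zero

end CovEst

theorem theorem2 {Ω : Type*} [MeasurableSpace Ω] (P : Measure Ω) [IsProbabilityMeasure P]
    (d n : ℕ) (hd : 0 < d)
    (X₀ : Ω → Fin d → ℝ) (X : Fin n → Ω → Fin d → ℝ)
    (hX_indep : iIndepFun X P)
    (hX_ident : ∀ i, IdentDistrib (X i) X₀ P P)
    (hX_sq : ∀ k, MemLp (fun ω => X₀ ω k) 2 P)
    (hX_mean : ∀ k, ∫ ω, X₀ ω k ∂P = 0)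
    (S : Matrix (Fin d) (Fin d) ℝ) (hS : CovEst.secondMoment P X₀ = S) (hS_inv : IsUnit S)
    (α : ℝ) (hα : CovEst.FourthMomentCondition P (fun ω => CovEst.whiten S (X₀ ω)) α)
    (hn₁ : 7 * α ^ 2 * CovEst.effRank (S ^ 2) ^ 2
        * (CovEst.effRank S ^ 2 + α * CovEst.effRank (S ^ 2)) ≤ (n : ℝ))
    (hn₂ : 96 * (1 + Real.sqrt α) ^ 2 * CovEst.effRank (S ^ 2)
        * (CovEst.effRank S ^ 2 + α * CovEst.effRank (S ^ 2)) ≤ (n : ℝ)) :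
    Integrable (fun ω => CovEst.frobNorm (CovEst.sampleCov (fun i => X i ω) - S) ^ 2) P ∧
    ∀ δ : ℝ, 0 < δ → δ < 1 →
      1 - δ ≤ P.real {ω |
        CovEst.frobNorm (CovEst.sampleCov (fun i => X i ω) - S) ^ 2
            - ∫ ω', CovEst.frobNorm (CovEst.sampleCov (fun i => X i ω') - S) ^ 2 ∂P
          > -(4 * CovEst.opNorm S ^ 2 / (n : ℝ))
              * max (2 * Real.log (5 / δ))
                  (Real.sqrt (2 * CovEst.varFactor S α n * Real.log (5 / δ)))} := by
  have hps := CovEst.posSemidef_of_secondMoment hX_sq hS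
  have hpos := CovEst.opNorm_pos_of_isUnit hd hS_inv
  have hα0 := hα.1
  have hb := CovEst.one_le_effRank_sq hps.isHermitian hpos
  have hbr := CovEst.effRank_sq_le hps hpos
  have hr : 1 ≤ CovEst.effRank S := hb.trans hbr
  have hn' : (0 : ℝ) < n := lt_of_lt_of_le (by positivity) hn₂
  have hn : 0 < n := by exact_mod_cast hn'
  have hmeas := CovEst.measurable_centredVec S
  have hind : iIndepFun (fun i ω => CovEst.centredVec S (X i ω)) P :=
    hX_indep.comp (fun _ => CovEst.centredVec S) fun _ => hmeas
  have hid : ∀ i, IdentDistrib (fun ω => CovEst.centredVec S (X i ω))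
      (fun ω => CovEst.centredVec S (X₀ ω)) P P := fun i => (hX_ident i).comp hmeas
  have hcoord := CovEst.memLp_two_centredVec hX_sq hS hS_inv hα
  obtain ⟨hWi, hWint⟩ := CovEst.integral_sum_dotProduct_sum hind hid (fun k => (hcoord k).1)
    fun k => (hcoord k).2
  have hvec : ∀ v : Fin d × Fin d → ℝ, MemLp (fun ω => v ⬝ᵥ CovEst.centredVec S (X₀ ω)) 4 P ∧
      ∫ ω, v ⬝ᵥ CovEst.centredVec S (X₀ ω) ∂P = 0 ∧
      ∫ ω, (v ⬝ᵥ CovEst.centredVec S (X₀ ω)) ^ 4 ∂P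
        ≤ α ^ 2 * (v ⬝ᵥ (CovEst.tensorSq S).mulVec v) ^ 2 := fun v => by
    obtain ⟨V, rfl⟩ := Matrix.vec_bijective.surjective v
    exact CovEst.memLp_four_vec_dotProduct_centredVec hX_sq hS hS_inv hα V
  set σ := CovEst.opNorm S with hσ
  set Q := CovEst.momentMatrix P fun ω => CovEst.centredVec S (X₀ ω) with hQ
  set W : Ω → ℝ := fun ω => (n : ℝ)⁻¹ * ((∑ i, CovEst.centredVec S (X i ω)) ⬝ᵥ
    ∑ i, CovEst.centredVec S (X i ω)) with hW
  have hfrob : ∀ ω, CovEst.frobNorm (CovEst.sampleCov (fun i => X i ω) - S) ^ 2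
      = σ ^ 2 / n * W ω := fun ω =>
    CovEst.frobNorm_sampleCov_sub_sq hn hpos fun i => X i ω
  have hWi' : Integrable W P := hWi.const_mul _
  have hWm : ∫ ω, W ω ∂P = Q.trace := by
    rw [hW, integral_const_mul, hWint]
    field_simp
  have hW0 : ∀ ω, 0 ≤ W ω := fun ω => by
    have h := hfrob ω
    have h1 : 0 < σ ^ 2 / n := by positivity
    exact nonneg_of_mul_nonneg_right (h ▸ sq_nonneg _) h1
  have hV0 : 0 ≤ CovEst.effRank (S ^ 4) := by
    rw [CovEst.effRank, show S ^ 4 = (S ^ 2) * (S ^ 2) by rw [← pow_add]]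
    refine div_nonneg ?_ (CovEst.opNorm_nonneg _)
    rw [CovEst.trace_sq_eq_sum_eigenvalues (hps.isHermitian.pow 2)]
    exact Finset.sum_nonneg fun i _ => sq_nonneg _
  have hR0 : 0 ≤ CovEst.varFactor S α n := by
    rw [CovEst.varFactor]
    positivity
  simp_rw [hfrob]
  refine ⟨hWi'.const_mul _, fun δ hδ hδ1 => ?_⟩
  rw [integral_const_mul, hWm]
  have hlog : 0 < Real.log (5 / δ) := Real.log_pos (by rw [lt_div_iff₀ hδ]; linarith)
  have htail := CovEst.measureReal_le_two_mul_exp_neg (W := W) (m := Q.trace)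
    (R := CovEst.varFactor S α n) hWi'.aestronglyMeasurable.aemeasurable hW0 hlog hR0
    fun l hl hl' => by
      refine (CovEst.integral_exp_neg_le_two_mul_exp hn hl hl' hα0 hind hid (fun v => (hvec v).1)
        (fun k => (hcoord k).1) (fun v => (hvec v).2.1) (fun v => (hvec v).2.2)
        (CovEst.tensorSq_posSemidef hps) (CovEst.dotProduct_tensorSq_mulVec_le hps hpos)
        (CovEst.trace_tensorSq S) (CovEst.trace_tensorSq_mul_self hps.isHermitian) hb
        (pow_le_pow_left₀ (zero_le_one.trans hb) hbr 2)
        (CovEst.trace_momentMatrix_centredVec_le hX_sq hS hS_inv hα hpos) hn₁).trans ?_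
      refine mul_le_mul_of_nonneg_left (Real.exp_le_exp.2 ?_) zero_le_two
      have h := CovEst.trace_momentMatrix_centredVec_mul_self_le hX_sq hS hS_inv hα hpos
      refine add_le_add le_rfl (mul_le_mul_of_nonneg_left ?_ (by positivity))
      rw [CovEst.varFactor]
      exact add_le_add h le_rfl
  rw [Real.exp_neg, Real.exp_log (by positivity)] at htail
  -- Subadditivity over a cover of the space needs no measurability of either event.
  have hcover : (1 : ℝ) ≤ P.real ({ω | σ ^ 2 / n * W ω - σ ^ 2 / n * Q.trace
      > -(4 * σ ^ 2 / (n : ℝ)) * max (2 * Real.log (5 / δ))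
        (Real.sqrt (2 * CovEst.varFactor S α n * Real.log (5 / δ)))} ∪
      {ω | W ω ≤ Q.trace - 4 * max (2 * Real.log (5 / δ))
        (Real.sqrt (2 * CovEst.varFactor S α n * Real.log (5 / δ)))}) := by
    rw [Set.eq_univ_of_forall (s := _ ∪ _) fun ω => ?_, probReal_univ]
    by_cases h : W ω ≤ Q.trace - 4 * max (2 * Real.log (5 / δ))
        (Real.sqrt (2 * CovEst.varFactor S α n * Real.log (5 / δ)))
    · exact Or.inr h
    · left
      have h1 : 0 < σ ^ 2 / n := by positivity
      have h2 := mul_lt_mul_of_pos_left (not_le.1 h) h1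
      simp only [gt_iff_lt, Set.mem_ofPred_eq]
      have h3 : -(4 * σ ^ 2 / (n : ℝ)) = -4 * (σ ^ 2 / n) := by ring
      rw [h3]
      linarith
  have hunion := hcover.trans (measureReal_union_le _ _)
  -- The tail is 2δ/5, so the constant 5 leaves slack.
  have hδ5 : 2 * (5 / δ)⁻¹ ≤ δ := by
    rw [inv_div]
    linarith
  linarith
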